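/- **Setting.** Let $0<\gamma<n$ and $1<p\le\alpha<q\le\infty$ ($p,\alpha$ finite), $p'=p/(p-1)$. A *weight* on $\mathbb R^n$ is a non-negative locally integrable function $w$; $w(E)=\int_E w\,dx$. Cubes $Q=Q(y,\ell)$ (centre $y$, side length $\ell>0$) have sides parallel to the axes, and $2Q(y,\ell):=Q(y,2\sqrt n\,\ell)$. We write $\mu\in\Delta_2$ if $\mu(2Q)\le C\mu(Q)$ for all cubes $Q$, and $w\in A_\infty$ if for some $1<s<\infty$ the quantities $\big(\frac1{|Q|}\int_Q w\big)^{1/s}\big(\frac1{|Q|}\int_Q w^{-s'/s}\big)^{1/s'}$ are bounded uniformly in $Q$. $\mathrm{BMO}(\mathbb R^n)$ is the space of locally integrable $b$ with $\sup_Q\frac1{|Q|}\int_Q|b-b_Q|<\infty$, $b_Q=\frac1{|Q|}\int_Q b$. For $\mathcal A(t)=t^{p'}[\log(e+t)]^{p'}$ let $\|f\|_{\mathcal A,Q}=\inf\{\lambda>0:\frac1{|Q|}\int_Q\mathcal A(|f|/\lambda)\,dx\le1\}$. Functions are real- or complex-valued. For weights $\nu,w,\mu$, $(L^p,L^q)^\alpha(\nu,w;\mu)$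 is the set of locally integrable $f$ with $$\|f\|_{(L^p,L^q)^\alpha(\nu,w;\mu)}:=\sup_{\ell>0}\Big\|w(Q(y,\ell))^{1/\alpha-1/p-1/q}\,\|f\chi_{Q(y,\ell)}\|_{L^p(\nu)}\Big\|_{L^q(\mu)}<\infty$$ (the $L^q(\mu)$ norm being taken in $y$), and $(WL^p,L^q)^\alpha(w;\mu)$ is the set of measurable $f$ for which the same expression with $\|f\chi_{Q(y,\ell)}\|_{WL^p(w)}$ in place of $\|f\chi_{Q(y,\ell)}\|_{L^p(\nu)}$ is finite, where $\|g\|_{WL^p(w)}=\sup_{\sigma>0}\sigma\, w(\{|g|>\sigma\})^{1/p}$. **The operator.** Let $b\in\mathrm{BMO}(\mathbb R^n)$, and let $D$ be a vector space of locally integrable functions with $f\chi_Q\in D$ for all $f\in D$ and all cubes $Q$. Let $[b,\mathcal T_\gamma]$ denote an operator from $D$ to measurable functions that is linear or sublinear (for $f,g\in D$ and scalars $c$, almost everywhere $|[b,\mathcal T_\gamma](f+g)|\le|[b,\mathcal T_\gamma](f)|+|[b,\mathcal T_\gamma](g)|$ and $|[b,\mathcal T_\gamma](cf)|=|c|\,|[b,\mathcal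 T_\gamma](f)|$) and satisfies, with a constant $c_4$ independent of $f$ and $x$, for every $f\in D$ and almost every $x\notin\mathrm{supp}\,f$, $$\big|[b,\mathcal T_\gamma](f)(x)\big|\le c_4\int_{\mathbb R^n}\frac{|b(x)-b(y)|\,|f(y)|}{|x-y|^{n-\gamma}}\,dy .$$ **Theorem.** Let $w,\nu,\mu$ be weights with $\mu\in\Delta_2$ and $w\in A_\infty$. Assume that for some $r>1$ there is $C<\infty$ such that for all cubes $Q$ $$|Q|^{\gamma/n}\Big(\frac1{|Q|}\int_Q w^r\,dx\Big)^{1/(rp)}\big\|\nu^{-1/p}\big\|_{\mathcal A,Q}\le C ,$$ and that for some $C<\infty$, all $f\in D$ and all $\sigma>0$, $$w\big(\{x:|[b,\mathcal T_\gamma](f)(x)|>\sigma\}\big)\le\frac{C}{\sigma^p}\int_{\mathbb R^n}|f|^p\nu\,dx .$$ Then there is a constant $C<\infty$ such that for every $f\in D\cap(L^p,L^q)^\alpha(\nu,w;\mu)$ one has $[b,\mathcal T_\gamma](f)\in(WL^p,L^q)^\alpha(w;\mu)$ and $$\big\|[b,\mathcal T_\gamma](f)\big\|_{(WL^p,L^q)^\alpha(w;\mu)}\le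 C\,\|f\|_{(L^p,L^q)^\alpha(\nu,w;\mu)} .$$ In particular, if $(L^p,L^q)^\alpha(\nu,w;\mu)\subset D$, then $[b,\mathcal T_\gamma]$ is bounded from $(L^p,L^q)^\alpha(\nu,w;\mu)$ to $(WL^p,L^q)^\alpha(w;\mu)$. -/

import Mathlib

open MeasureTheory
open scoped ENNReal NNReal

noncomputable section

namespace WeightedAmalgam

/-- The closed cube `Q(x, ℓ)` with centre `x` and side length `ℓ`, sides parallel to the axes. -/
def cube {n : ℕ} (x : EuclideanSpace ℝ (Fin n)) (ℓ : ℝ) : Set (EuclideanSpace ℝ (Fin n)) :=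
  {y | ∀ i, |y i - x i| ≤ ℓ / 2}

/-- A weight: a non-negative locally integrable function. -/
structure IsWeight {n : ℕ} (w : EuclideanSpace ℝ (Fin n) → ℝ) : Prop where
  nonneg : ∀ x, 0 ≤ w x
  locallyIntegrable : LocallyIntegrable w volume

/-- The weighted measure `w(E) = ∫_E w(x) dx`. -/
def wMeasure {n : ℕ} (w : EuclideanSpace ℝ (Fin n) → ℝ) : Measure (EuclideanSpace ℝ (Fin n)) :=
  volume.withDensity fun x => ENNReal.ofReal (w x)

/-- The doubling condition `Δ₂`: `w(2Q) ≤ C w(Q)` for all cubes, where `2Q = Q(x, 2√n ℓ)`. -/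
def IsDoubling {n : ℕ} (w : EuclideanSpace ℝ (Fin n) → ℝ) : Prop :=
  ∃ C : ℝ≥0, ∀ (x : EuclideanSpace ℝ (Fin n)) (ℓ : ℝ), 0 < ℓ →
    wMeasure w (cube x (2 * √(n : ℝ) * ℓ)) ≤ C * wMeasure w (cube x ℓ)

/-- Muckenhoupt's class `A_s`, `1 < s < ∞` (computed in `[0, ∞]`, so that `0 ^ (-s'/s) = ∞`). -/
def IsMuckenhoupt {n : ℕ} (s : ℝ) (w : EuclideanSpace ℝ (Fin n) → ℝ) : Prop :=
  ∃ C : ℝ≥0, ∀ (x : EuclideanSpace ℝ (Fin n)) (ℓ : ℝ), 0 < ℓ →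
    (⨍⁻ y in cube x ℓ, ENNReal.ofReal (w y) ∂volume) ^ (1 / s) *
      (⨍⁻ y in cube x ℓ, ENNReal.ofReal (w y) ^ (-(Real.conjExponent s / s)) ∂volume)
        ^ (1 / Real.conjExponent s) ≤ C

/-- `A_∞` is the union of the classes `A_s`, `1 < s < ∞`. -/
def IsMuckenhouptInfty {n : ℕ} (w : EuclideanSpace ℝ (Fin n) → ℝ) : Prop :=
  ∃ s : ℝ, 1 < s ∧ IsMuckenhoupt s w

/-- The space `BMO(ℝⁿ)`. -/
def IsBMO {n : ℕ} {𝕜 : Type*} [RCLike 𝕜] (b : EuclideanSpace ℝ (Fin n) → 𝕜) : Prop :=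
  LocallyIntegrable b volume ∧
    ∃ M : ℝ, ∀ (x : EuclideanSpace ℝ (Fin n)) (ℓ : ℝ), 0 < ℓ →
      ⨍ y in cube x ℓ, ‖b y - ⨍ z in cube x ℓ, b z ∂volume‖ ∂volume ≤ M

/-- The Young function `t ↦ t ^ p' * log (e + t) ^ p'`, extended to `[0, ∞]`;
its value at `∞` is `∞`, since there the first factor is `∞` and the second one is `1`. -/
def youngLog (p : ℝ) (t : ℝ≥0∞) : ℝ≥0∞ :=
  t ^ Real.conjExponent p *
    ENNReal.ofReal (Real.log (Real.exp 1 + t.toReal)) ^ Real.conjExponent p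

/-- The Luxemburg average over `Q` of a `[0, ∞]`-valued function; it is `∞` when no `t` is
admissible. -/
def luxemburg {n : ℕ} (A : ℝ≥0∞ → ℝ≥0∞) (f : EuclideanSpace ℝ (Fin n) → ℝ≥0∞)
    (Q : Set (EuclideanSpace ℝ (Fin n))) : ℝ≥0∞ :=
  ⨅ (t : ℝ) (_ : 0 < t ∧ ⨍⁻ x in Q, A (f x / ENNReal.ofReal t) ∂volume ≤ 1), ENNReal.ofReal t

/-- The `A_p`-type condition on `(w, ν)` with power bump `r` on `w`, Orlicz bump on `ν`, and
order `γ`, for all cubes. -/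
def BumpCondition {n : ℕ} (γ p r : ℝ) (w ν : EuclideanSpace ℝ (Fin n) → ℝ) : Prop :=
  ∃ C : ℝ≥0, ∀ (x : EuclideanSpace ℝ (Fin n)) (ℓ : ℝ), 0 < ℓ →
    volume (cube x ℓ) ^ (γ / n) *
      (⨍⁻ y in cube x ℓ, ENNReal.ofReal (w y) ^ r ∂volume) ^ (1 / (r * p)) *
      luxemburg (youngLog p) (fun y => ENNReal.ofReal (ν y) ^ (-(1 / p))) (cube x ℓ) ≤ C

/-- The norm of the weighted weak Lebesgue space `WL^p(w)`. -/
def weakLpNorm {n : ℕ} {𝕜 : Type*} [RCLike 𝕜] (p : ℝ) (w : EuclideanSpace ℝ (Fin n) → ℝ)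
    (g : EuclideanSpace ℝ (Fin n) → 𝕜) : ℝ≥0∞ :=
  ⨆ (σ : ℝ) (_ : 0 < σ), ENNReal.ofReal σ * wMeasure w {x | σ < ‖g x‖} ^ (1 / p)

/-- The norm of the weighted amalgam space `(L^p, L^q)^α(ν, w; μ)`, for `p`, `α` finite and
`q` possibly infinite. -/
def amalgamNorm {n : ℕ} {𝕜 : Type*} [RCLike 𝕜] (p α : ℝ) (q : ℝ≥0∞)
    (ν w μ : EuclideanSpace ℝ (Fin n) → ℝ) (f : EuclideanSpace ℝ (Fin n) → 𝕜) : ℝ≥0∞ :=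
  ⨆ (ℓ : ℝ) (_ : 0 < ℓ),
    eLpNorm (fun y => wMeasure w (cube y ℓ) ^ (1 / α - 1 / p - (1 / q).toReal) *
      eLpNorm ((cube y ℓ).indicator f) (ENNReal.ofReal p) (wMeasure ν)) q (wMeasure μ)

/-- The norm of the weighted weak amalgam space `(WL^p, L^q)^α(w; μ)`. -/
def weakAmalgamNorm {n : ℕ} {𝕜 : Type*} [RCLike 𝕜] (p α : ℝ) (q : ℝ≥0∞)
    (w μ : EuclideanSpace ℝ (Fin n) → ℝ) (g : EuclideanSpace ℝ (Fin n) → 𝕜) : ℝ≥0∞ :=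
  ⨆ (ℓ : ℝ) (_ : 0 < ℓ),
    eLpNorm (fun y => wMeasure w (cube y ℓ) ^ (1 / α - 1 / p - (1 / q).toReal) *
      weakLpNorm p w ((cube y ℓ).indicator g)) q (wMeasure μ)

/-- Membership in the weighted amalgam space. -/
def MemAmalgam {n : ℕ} {𝕜 : Type*} [RCLike 𝕜] (p α : ℝ) (q : ℝ≥0∞)
    (ν w μ : EuclideanSpace ℝ (Fin n) → ℝ) (f : EuclideanSpace ℝ (Fin n) → 𝕜) : Prop :=
  LocallyIntegrable f volume ∧ amalgamNorm p α q ν w μ f < ∞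

/-- Membership in the weighted weak amalgam space. -/
def MemWeakAmalgam {n : ℕ} {𝕜 : Type*} [RCLike 𝕜] (p α : ℝ) (q : ℝ≥0∞)
    (w μ : EuclideanSpace ℝ (Fin n) → ℝ) (g : EuclideanSpace ℝ (Fin n) → 𝕜) : Prop :=
  AEStronglyMeasurable g volume ∧ weakAmalgamNorm p α q w μ g < ∞

/-- `T` is a linear or sublinear operator on the vector space `D` of locally integrable functions,
with measurable functions as values; `D` is stable under restriction to cubes. The values of `T`
outside `D` are irrelevant. -/
structure IsSublinearOperator {n : ℕ} {𝕜 : Type*} [RCLike 𝕜]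
    (D : Submodule 𝕜 (EuclideanSpace ℝ (Fin n) → 𝕜))
    (T : (EuclideanSpace ℝ (Fin n) → 𝕜) → (EuclideanSpace ℝ (Fin n) → 𝕜)) : Prop where
  locallyIntegrable : ∀ f ∈ D, LocallyIntegrable f volume
  restrict_mem : ∀ f ∈ D, ∀ (x : EuclideanSpace ℝ (Fin n)) (ℓ : ℝ), 0 < ℓ →
    (cube x ℓ).indicator f ∈ D
  measurable : ∀ f ∈ D, AEStronglyMeasurable (T f) volume
  add_le : ∀ f ∈ D, ∀ g ∈ D, ∀ᵐ x ∂volume, ‖T (f + g) x‖ ≤ ‖T f x‖ + ‖T g x‖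
  smul_eq : ∀ (c : 𝕜), ∀ f ∈ D, ∀ᵐ x ∂volume, ‖T (c • f) x‖ = ‖c‖ * ‖T f x‖

/-- The size condition of a commutator of order `γ` with symbol `b`:
`|T f(x)| ≤ c ∫ |b(x) - b(y)| |f(y)| / |x - y|^(n-γ) dy` for `f ∈ D` and (almost every)
`x ∉ supp f`. -/
def CommutatorSize {n : ℕ} {𝕜 : Type*} [RCLike 𝕜] (γ : ℝ) (b : EuclideanSpace ℝ (Fin n) → 𝕜)
    (D : Submodule 𝕜 (EuclideanSpace ℝ (Fin n) → 𝕜))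
    (T : (EuclideanSpace ℝ (Fin n) → 𝕜) → (EuclideanSpace ℝ (Fin n) → 𝕜)) : Prop :=
  ∃ c : ℝ≥0, ∀ f ∈ D, ∀ᵐ x ∂volume, x ∉ tsupport f →
    ‖T f x‖ₑ ≤ c * ∫⁻ y, ‖b x - b y‖ₑ * ‖f y‖ₑ / ‖x - y‖ₑ ^ ((n : ℝ) - γ) ∂volume

/-- The two-weight weak-type `(p, p)` inequality for `T` on `D`. -/
def WeakType {n : ℕ} {𝕜 : Type*} [RCLike 𝕜] (p : ℝ) (w ν : EuclideanSpace ℝ (Fin n) → ℝ)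
    (D : Submodule 𝕜 (EuclideanSpace ℝ (Fin n) → 𝕜))
    (T : (EuclideanSpace ℝ (Fin n) → 𝕜) → (EuclideanSpace ℝ (Fin n) → 𝕜)) : Prop :=
  ∃ C : ℝ≥0, ∀ f ∈ D, ∀ σ : ℝ, 0 < σ →
    wMeasure w {x | σ < ‖T f x‖} ≤
      C / ENNReal.ofReal σ ^ p * ∫⁻ x, ‖f x‖ₑ ^ p * ENNReal.ofReal (ν x) ∂volume

end WeightedAmalgam

end

noncomputable section

namespace WeightedAmalgam

open Set Filter Topology

variable {n : ℕ} {𝕜 : Type*} [RCLike 𝕜]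

/-! Fix `Q = Q(y, ℓ)`, put `Q_k = Q(y, 2^k ℓ)`, and split `f` into its restriction to `Q_1` and the
rest. The weak-type hypothesis controls the near part. On `Q` the far part obeys the size condition,
and its integral is cut into the annuli `Q_{j+2} \ Q_{j+1}`. There `|b(x) - b(z)|` is at most a
product of `1 + |b(x) - b_Q|`, a factor linear in `j`, and `1 + |b(z) - b_{Q_{j+2}}|`. The last
factor is absorbed by generalised Hölder: exponential integrability of `b` against the Orlicz bump
on `ν`, so that each annulus costs `w(Q_{j+2})^{-1/p} ‖f χ_{Q_{j+2}}‖_{L^p(ν)}`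
(`BumpCondition.exists_lintegral_le`). The first factor has weak `L^p(w)` norm on `Q` at most a
constant times `w(Q)^{1/p}`, by a John–Nirenberg inequality for `w` (`IsBMO.exists_weak_le`).

With `κ = 1/α - 1/p - 1/q`, multiplication by `w(Q)^κ` leaves the factor `(w(Q)/w(Q_k))^δ`, where `δ
= κ + 1/p = 1/α - 1/q > 0` because `α < q`. Membership in `A_∞` gives `w(Q) ≤ η^k w(Q_k)` with `η <
1`, and this geometric decay beats the linear growth. Hence the local weak norm of `T f` is
dominated pointwise in `y` by a summable combination of local norms of `f` at the scales `2^k ℓ`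
(`exists_local_weak_le`), and Minkowski's inequality in `L^q(μ)` finishes.

Both John–Nirenberg inequalities, for `w` and for Lebesgue measure, come from one Calderón–Zygmund
induction that uses only `HalfDecay`. -/

/-! ### Geometry of cubes and half-open boxes. -/

theorem isClosed_cube (x : EuclideanSpace ℝ (Fin n)) (ℓ : ℝ) : IsClosed (cube x ℓ) := by
  simp only [cube, ofPred_forall]
  exact isClosed_iInter fun i => isClosed_le (by fun_prop) continuous_const

theorem measurableSet_cube (x : EuclideanSpace ℝ (Fin n)) (ℓ : ℝ) : MeasurableSet (cube x ℓ) :=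
  (isClosed_cube x ℓ).measurableSet

theorem cube_eq_preimage (x : EuclideanSpace ℝ (Fin n)) (ℓ : ℝ) :
    cube x ℓ = (MeasurableEquiv.toLp 2 (Fin n → ℝ)).symm ⁻¹'
      Icc (fun i => x i - ℓ / 2) (fun i => x i + ℓ / 2) := by
  ext y
  simp only [cube, mem_ofPred_eq, mem_preimage, mem_Icc, Pi.le_def, ← forall_and, abs_le]
  refine forall_congr' fun i => ?_
  constructor
  · rintro ⟨h1, h2⟩
    exact ⟨by change _ ≤ y i; linarith, by change y i ≤ _; linarith⟩
  · rintro ⟨h1, h2⟩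
    change _ ≤ y i at h1
    change y i ≤ _ at h2
    exact ⟨by linarith, by linarith⟩

theorem volume_cube (x : EuclideanSpace ℝ (Fin n)) (ℓ : ℝ) :
    volume (cube x ℓ) = ENNReal.ofReal ℓ ^ n := by
  rw [cube_eq_preimage,
    (EuclideanSpace.volume_preserving_symm_measurableEquiv_toLp (Fin n)).measure_preimage
      measurableSet_Icc.nullMeasurableSet, Real.volume_Icc_pi]
  simp

theorem volume_cube_ne_top (x : EuclideanSpace ℝ (Fin n)) (ℓ : ℝ) : volume (cube x ℓ) ≠ ∞ := by
  rw [volume_cube]; finiteness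

theorem volume_cube_ne_zero (x : EuclideanSpace ℝ (Fin n)) {ℓ : ℝ} (hℓ : 0 < ℓ) :
    volume (cube x ℓ) ≠ 0 := by
  rw [volume_cube]
  exact pow_ne_zero _ (by simpa using hℓ)

/-- The half-open box with lower corner `a` and side length `ℓ`. -/
def box (a : Fin n → ℝ) (ℓ : ℝ) : Set (EuclideanSpace ℝ (Fin n)) :=
  {y | ∀ i, a i ≤ y i ∧ y i < a i + ℓ}

/-- The closed cube with lower corner `a` and side length `ℓ`. -/
def cornerCube (a : Fin n → ℝ) (ℓ : ℝ) : Set (EuclideanSpace ℝ (Fin n)) :=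
  cube (WithLp.toLp 2 fun i => a i + ℓ / 2) ℓ

theorem mem_cornerCube {a : Fin n → ℝ} {ℓ : ℝ} {y : EuclideanSpace ℝ (Fin n)} :
    y ∈ cornerCube a ℓ ↔ ∀ i, a i ≤ y i ∧ y i ≤ a i + ℓ := by
  simp only [cornerCube, cube, mem_ofPred_eq, abs_le]
  refine forall_congr' fun i => ?_
  constructor <;> rintro ⟨h1, h2⟩ <;> constructor <;> linarith

theorem cube_eq_cornerCube (x : EuclideanSpace ℝ (Fin n)) (ℓ : ℝ) :
    cube x ℓ = cornerCube (fun i => x i - ℓ / 2) ℓ := by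
  simp [cornerCube]

theorem box_eq_preimage (a : Fin n → ℝ) (ℓ : ℝ) :
    box a ℓ = (MeasurableEquiv.toLp 2 (Fin n → ℝ)).symm ⁻¹'
      (Set.pi univ fun i => Ico (a i) (a i + ℓ)) := by
  ext y
  simp only [mem_preimage, mem_univ_pi, mem_Ico]
  rfl

theorem measurableSet_box (a : Fin n → ℝ) (ℓ : ℝ) : MeasurableSet (box a ℓ) := by
  rw [box_eq_preimage]
  exact (MeasurableEquiv.measurable _) (MeasurableSet.univ_pi fun i => measurableSet_Ico)

theorem volume_box (a : Fin n → ℝ) (ℓ : ℝ) : volume (box a ℓ) = ENNReal.ofReal ℓ ^ n := by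
  rw [box_eq_preimage,
    (EuclideanSpace.volume_preserving_symm_measurableEquiv_toLp (Fin n)).measure_preimage
      (MeasurableSet.univ_pi fun i => measurableSet_Ico).nullMeasurableSet, Real.volume_pi_Ico]
  simp

theorem box_subset_cornerCube (a : Fin n → ℝ) (ℓ : ℝ) : box a ℓ ⊆ cornerCube a ℓ :=
  fun _ hy => mem_cornerCube.2 fun i => ⟨(hy i).1, (hy i).2.le⟩

/-- Half-open boxes partition space dyadically, while averages of `b` are taken over closed cubes;
this permits passing between the two under any integral. -/
theorem box_ae_eq_cornerCube (a : Fin n → ℝ) (ℓ : ℝ) :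
    box a ℓ =ᵐ[volume] cornerCube a ℓ := by
  refine ae_eq_of_subset_of_measure_ge (box_subset_cornerCube a ℓ) ?_
    (measurableSet_box a ℓ).nullMeasurableSet (volume_cube_ne_top _ _)
  rw [volume_box, cornerCube, volume_cube]

theorem cube_subset_cube (x : EuclideanSpace ℝ (Fin n)) {ℓ ℓ' : ℝ} (h : ℓ ≤ ℓ') :
    cube x ℓ ⊆ cube x ℓ' := fun y hy i => (hy i).trans (by linarith)

theorem abs_apply_le_norm (x : EuclideanSpace ℝ (Fin n)) (i : Fin n) : |x i| ≤ ‖x‖ := by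
  simpa using PiLp.norm_apply_le x i

theorem ball_subset_cube (x : EuclideanSpace ℝ (Fin n)) (ℓ : ℝ) :
    Metric.ball x (ℓ / 2) ⊆ cube x ℓ := by
  intro y hy i
  rw [Metric.mem_ball, dist_eq_norm] at hy
  exact (abs_apply_le_norm (y - x) i).trans hy.le

theorem norm_le_of_apply_le {x : EuclideanSpace ℝ (Fin n)} {r : ℝ} (hr : 0 ≤ r)
    (h : ∀ i, |x i| ≤ r) : ‖x‖ ≤ √n * r := by
  rw [EuclideanSpace.norm_eq]
  refine (Real.sqrt_le_sqrt (Finset.sum_le_sum fun i _ =>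
    pow_le_pow_left₀ (norm_nonneg _) (h i) 2)).trans ?_
  simp [Real.sqrt_mul, Real.sqrt_sq hr]

theorem cube_subset_closedBall (x : EuclideanSpace ℝ (Fin n)) {ℓ : ℝ} (hℓ : 0 ≤ ℓ) :
    cube x ℓ ⊆ Metric.closedBall x (√n * ℓ) := by
  intro y hy
  rw [Metric.mem_closedBall, dist_eq_norm]
  exact norm_le_of_apply_le hℓ fun i => (hy i).trans (by linarith)

theorem isCompact_cube (x : EuclideanSpace ℝ (Fin n)) {ℓ : ℝ} (hℓ : 0 ≤ ℓ) :
    IsCompact (cube x ℓ) :=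
  (isCompact_closedBall x (√n * ℓ)).of_isClosed_subset (isClosed_cube x ℓ)
    (cube_subset_closedBall x hℓ)

theorem cornerCube_subset_closedBall {a : Fin n → ℝ} {ℓ : ℝ} (hℓ : 0 ≤ ℓ)
    {x : EuclideanSpace ℝ (Fin n)} (hx : x ∈ cornerCube a ℓ) :
    cornerCube a ℓ ⊆ Metric.closedBall x (√n * ℓ) := by
  intro y hy
  rw [Metric.mem_closedBall, dist_eq_norm]
  rw [mem_cornerCube] at hx hy
  refine norm_le_of_apply_le hℓ fun i => ?_
  have := hx i
  have := hy i
  rw [abs_le]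
  constructor <;> simp <;> linarith

/-! ### Lebesgue differentiation along cubes. -/

/-- The constant in the Vitali family adapted to cubes. -/
def cubeVitaliConst (n : ℕ) : ℝ≥0 :=
  (3 * (√n).toNNReal) ^ n * (volume (Metric.ball (0 : EuclideanSpace ℝ (Fin n)) 1)).toNNReal + 3 ^ n

theorem volume_closedBall_three_mul_le (x : EuclideanSpace ℝ (Fin n)) {r : ℝ} (hr : 0 < r) :
    volume (Metric.closedBall x (3 * r)) ≤ cubeVitaliConst n * volume (Metric.closedBall x r) := by
  rw [Measure.addHaar_closedBall _ _ (by positivity), Measure.addHaar_closedBall _ _ hr.le,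
    finrank_euclideanSpace_fin, mul_pow, ENNReal.ofReal_mul (by positivity), mul_assoc]
  gcongr
  rw [ENNReal.ofReal_pow (by positivity), cubeVitaliConst]
  push_cast
  norm_num

/-- A Vitali family containing all cubes of positive side length through a given point. -/
def cubeVitaliFamily (n : ℕ) : VitaliFamily (volume : Measure (EuclideanSpace ℝ (Fin n))) :=
  Vitali.vitaliFamily volume (cubeVitaliConst n) fun x =>
    ((eventually_mem_nhdsWithin (a := (0 : ℝ)) (s := Ioi 0)).mono fun _ hr =>
      volume_closedBall_three_mul_le x hr).frequently

/-- The point `x` need not be the centre, so the cube is enclosed in the ball of radius `√n ℓ` about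
`x`. The first summand of `cubeVitaliConst` bounds the tripled ball by the cube; the summand `3 ^ n`
is the tripling constant of balls. -/
theorem cornerCube_mem_setsAt {a : Fin n → ℝ} {ℓ : ℝ} (hℓ : 0 < ℓ)
    {x : EuclideanSpace ℝ (Fin n)} (hx : x ∈ cornerCube a ℓ) :
    cornerCube a ℓ ∈ (cubeVitaliFamily n).setsAt x := by
  refine ⟨isClosed_cube _ _, ⟨WithLp.toLp 2 fun i => a i + ℓ / 2,
    interior_mono (ball_subset_cube _ _) ?_⟩, √n * ℓ,
    cornerCube_subset_closedBall hℓ.le hx, ?_⟩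
  · rw [Metric.isOpen_ball.interior_eq]
    exact Metric.mem_ball_self (by linarith)
  · rw [Measure.addHaar_closedBall _ _ (by positivity), finrank_euclideanSpace_fin, cornerCube,
      volume_cube, cubeVitaliConst, ← mul_assoc, mul_pow, ENNReal.ofReal_mul (by positivity),
      ENNReal.ofReal_pow hℓ.le, ENNReal.ofReal_pow (by positivity),
      ENNReal.ofReal_mul (by norm_num)]
    push_cast
    rw [ENNReal.coe_toNNReal (by finiteness)]
    simp only [ENNReal.ofReal_ofNat]
    rw [mul_right_comm]
    gcongr
    exact le_self_add

/-- Lebesgue differentiation along shrinking cubes through a point. -/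
theorem ae_tendsto_cornerCube {φ : EuclideanSpace ℝ (Fin n) → ℝ≥0∞} (hφ : AEMeasurable φ volume)
    (hφ_int : ∫⁻ y, φ y ≠ ∞) :
    ∀ᵐ x ∂volume, ∀ (a : ℕ → Fin n → ℝ) (ℓ : ℕ → ℝ), (∀ m, 0 < ℓ m) → Tendsto ℓ atTop (𝓝 0) →
      (∀ m, x ∈ cornerCube (a m) (ℓ m)) →
      Tendsto (fun m => (∫⁻ y in cornerCube (a m) (ℓ m), φ y) / volume (cornerCube (a m) (ℓ m)))
        atTop (𝓝 (φ x)) := by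
  filter_upwards [(cubeVitaliFamily n).ae_tendsto_lintegral_div hφ hφ_int] with x hx a ℓ hℓ hℓ0 hxa
  refine hx.comp ?_
  rw [VitaliFamily.tendsto_filterAt_iff]
  refine ⟨Eventually.of_forall fun m => cornerCube_mem_setsAt (hℓ m) (hxa m), fun ε hε => ?_⟩
  have : Tendsto (fun m => √n * ℓ m) atTop (𝓝 0) := by simpa using hℓ0.const_mul (√n)
  filter_upwards [this.eventually (gt_mem_nhds hε)] with m hm
  exact (cornerCube_subset_closedBall (hℓ m).le (hxa m)).trans (Metric.closedBall_subset_closedBall hm.le)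

/-! ### Weighted measures and consequences of `A_∞`. -/

theorem wMeasure_absolutelyContinuous (w : EuclideanSpace ℝ (Fin n) → ℝ) :
    wMeasure w ≪ volume := withDensity_absolutelyContinuous _ _

theorem IsWeight.aemeasurable {w : EuclideanSpace ℝ (Fin n) → ℝ} (hw : IsWeight w) :
    AEMeasurable w volume := hw.locallyIntegrable.aestronglyMeasurable.aemeasurable

theorem wMeasure_cube (w : EuclideanSpace ℝ (Fin n) → ℝ) (x : EuclideanSpace ℝ (Fin n)) (ℓ : ℝ) :
    wMeasure w (cube x ℓ) = ∫⁻ y in cube x ℓ, ENNReal.ofReal (w y) :=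
  withDensity_apply _ (measurableSet_cube x ℓ)

theorem IsWeight.wMeasure_cube_ne_top {w : EuclideanSpace ℝ (Fin n) → ℝ} (hw : IsWeight w)
    (x : EuclideanSpace ℝ (Fin n)) {ℓ : ℝ} (hℓ : 0 ≤ ℓ) : wMeasure w (cube x ℓ) ≠ ∞ := by
  rw [wMeasure_cube]
  exact (hw.locallyIntegrable.integrableOn_isCompact (isCompact_cube x hℓ)).lintegral_lt_top.ne

/-- Hölder's inequality for `1 = w^{1/s} w^{-1/s}` on `E`, followed by enlarging the dual integral
from `E` to the cube, where the `A_s` condition bounds it. -/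
theorem IsMuckenhoupt.volume_mul_le {s : ℝ} (hs : 1 < s) {w : EuclideanSpace ℝ (Fin n) → ℝ}
    (hw : IsWeight w) (hwA : IsMuckenhoupt s w) :
    ∃ C : ℝ≥0, ∀ (x : EuclideanSpace ℝ (Fin n)) (ℓ : ℝ), 0 < ℓ → ∀ E ⊆ cube x ℓ, MeasurableSet E →
      volume E * wMeasure w (cube x ℓ) ^ (1 / s) ≤
        C * volume (cube x ℓ) * wMeasure w E ^ (1 / s) := by
  obtain ⟨C, hC⟩ := hwA
  refine ⟨C, fun x ℓ hℓ E hEQ hE => ?_⟩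
  have hconj : s.HolderConjugate (Real.conjExponent s) := Real.HolderConjugate.conjExponent hs
  set s' := Real.conjExponent s
  have hs0 : 0 < s := hconj.pos
  have hs'0 : 0 < s' := hconj.symm.pos
  have hC := hC x ℓ hℓ
  rw [setLAverage_eq, setLAverage_eq, ← wMeasure_cube] at hC
  set V := volume (cube x ℓ)
  have hV0 : V ≠ 0 := volume_cube_ne_zero x hℓ
  have hVt : V ≠ ∞ := volume_cube_ne_top x ℓ
  set I := wMeasure w (cube x ℓ) with hI
  set g : EuclideanSpace ℝ (Fin n) → ℝ≥0∞ := fun y => ENNReal.ofReal (w y)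
  have hg : AEMeasurable g volume := hw.aemeasurable.ennreal_ofReal
  set J := ∫⁻ y in cube x ℓ, g y ^ (-(s' / s))
  rcases eq_or_ne I 0 with hI0 | hI0
  · rw [hI0, ENNReal.zero_rpow_of_pos (by positivity)]; simp
  have hIt : I ≠ ∞ := hw.wMeasure_cube_ne_top x hℓ.le
  have hJ : J ≠ ∞ := by
    intro hJ
    rw [hJ, ENNReal.top_div_of_ne_top hVt, ENNReal.top_rpow_of_pos (by positivity),
      ENNReal.mul_top] at hC
    · simp at hC
    · have := ENNReal.div_pos hI0 hVt
      exact (ENNReal.rpow_pos this (ENNReal.div_ne_top hIt hV0)).ne'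
  have hprod : I ^ (1 / s) * J ^ (1 / s') ≤ C * V := by
    rw [ENNReal.div_rpow_of_nonneg _ _ (by positivity),
      ENNReal.div_rpow_of_nonneg _ _ (by positivity)] at hC
    have hVV : V ^ (1 / s) * V ^ (1 / s') = V := by
      rw [← ENNReal.rpow_add _ _ hV0 hVt, one_div, one_div, hconj.inv_add_inv_eq_one,
        ENNReal.rpow_one]
    calc I ^ (1 / s) * J ^ (1 / s')
        = (I ^ (1 / s) / V ^ (1 / s) * (J ^ (1 / s') / V ^ (1 / s'))) *
            (V ^ (1 / s) * V ^ (1 / s')) := by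
          rw [mul_mul_mul_comm, ENNReal.div_mul_cancel, ENNReal.div_mul_cancel]
          all_goals first
            | exact (ENNReal.rpow_pos (pos_iff_ne_zero.2 hV0) hVt).ne'
            | exact ENNReal.rpow_ne_top_of_nonneg (by positivity) hVt
      _ ≤ C * V := by rw [hVV]; gcongr
  -- Finiteness of the dual integral forces `w > 0` almost everywhere on the cube, so the
  -- factorisation of `1` is legitimate.
  have hae : ∀ᵐ y ∂(volume.restrict (cube x ℓ)), g y ^ (-(s' / s)) < ∞ :=
    ae_lt_top' (hg.restrict.pow_const _) hJ
  have hE1 : volume E ≤ wMeasure w E ^ (1 / s) * J ^ (1 / s') := by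
    calc volume E = ∫⁻ y in E, 1 := by simp
      _ = ∫⁻ y in E, ((fun y => g y ^ (1 / s)) * fun y => g y ^ (-(1 / s))) y := by
        refine lintegral_congr_ae ?_
        filter_upwards [ae_restrict_of_ae_restrict_of_subset hEQ hae] with y hy
        have hy0 : g y ≠ 0 := by
          intro h0
          rw [h0, ENNReal.zero_rpow_of_neg (by simp; positivity)] at hy
          exact lt_irrefl _ hy
        rw [Pi.mul_apply, ← ENNReal.rpow_add _ _ hy0 ENNReal.ofReal_ne_top]
        simp
      _ ≤ (∫⁻ y in E, (g y ^ (1 / s)) ^ s) ^ (1 / s) *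
            (∫⁻ y in E, (g y ^ (-(1 / s))) ^ s') ^ (1 / s') :=
        ENNReal.lintegral_mul_le_Lp_mul_Lq _ hconj (hg.restrict.pow_const _)
          (hg.restrict.pow_const _)
      _ ≤ wMeasure w E ^ (1 / s) * J ^ (1 / s') := by
        simp only [← ENNReal.rpow_mul]
        rw [one_div_mul_cancel hs0.ne', wMeasure, withDensity_apply _ hE]
        simp only [ENNReal.rpow_one]
        gcongr
        have : -(1 / s) * s' = -(s' / s) := by ring
        rw [this]
        exact lintegral_mono_set hEQ
  calc volume E * I ^ (1 / s) ≤ wMeasure w E ^ (1 / s) * J ^ (1 / s') * I ^ (1 / s) := by gcongr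
    _ = I ^ (1 / s) * J ^ (1 / s') * wMeasure w E ^ (1 / s) := by ring
    _ ≤ C * V * wMeasure w E ^ (1 / s) := by gcongr

/-- Subsets of a cube of at most half its volume carry at most the fraction `η` of the
`ω`-measure of the cube. -/
def HalfDecay (η : ℝ≥0) (ω : Measure (EuclideanSpace ℝ (Fin n))) : Prop :=
  ∀ (x : EuclideanSpace ℝ (Fin n)) (ℓ : ℝ), 0 < ℓ → ∀ E ⊆ cube x ℓ, MeasurableSet E →
    volume E ≤ volume (cube x ℓ) / 2 → ω E ≤ η * ω (cube x ℓ)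

theorem halfDecay_volume :
    HalfDecay (1 / 2) (volume : Measure (EuclideanSpace ℝ (Fin n))) := by
  intro x ℓ _ E _ _ h
  refine h.trans_eq ?_
  rw [ENNReal.div_eq_inv_mul]
  simp

/-- The complement of `E` has at least half the volume, so the `A_s` comparison gives it at least
the fraction `1/K` of the weight. What remains for `E` is `η = 1 - 1/K`. -/
theorem IsMuckenhouptInfty.halfDecay {w : EuclideanSpace ℝ (Fin n) → ℝ}
    (hw : IsWeight w) (hwA : IsMuckenhouptInfty w) :
    ∃ η : ℝ≥0, η < 1 ∧ HalfDecay η (wMeasure w) := by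
  obtain ⟨s, hs, hA⟩ := hwA
  obtain ⟨C, hC⟩ := hA.volume_mul_le hs hw
  have hs0 : 0 < s := by linarith
  set K : ℝ≥0 := (2 * C) ^ s + 1
  have hK : 1 ≤ K := by simp [K]
  have hK0 : 0 < K := by positivity
  refine ⟨1 - K⁻¹, tsub_lt_self one_pos (by positivity), fun x ℓ hℓ E hEQ hE hV => ?_⟩
  set Q := cube x ℓ
  have hF := hC x ℓ hℓ (Q \ E) sdiff_subset ((measurableSet_cube x ℓ).diff hE)
  have hQt : wMeasure w Q ≠ ∞ := hw.wMeasure_cube_ne_top x hℓ.le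
  have hV0 : volume Q ≠ 0 := volume_cube_ne_zero x hℓ
  have hVt : volume Q ≠ ∞ := volume_cube_ne_top x ℓ
  have hadd : wMeasure w E + wMeasure w (Q \ E) = wMeasure w Q := by
    rw [← measure_union disjoint_sdiff_right ((measurableSet_cube x ℓ).diff hE),
      union_sdiff_cancel hEQ]
  have hVF : volume Q / 2 ≤ volume (Q \ E) := by
    rw [measure_sdiff hEQ hE.nullMeasurableSet (ne_top_of_le_ne_top hVt (measure_mono hEQ))]
    refine ENNReal.le_sub_of_add_le_left (ne_top_of_le_ne_top hVt (measure_mono hEQ)) ?_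
    calc volume E + volume Q / 2 ≤ volume Q / 2 + volume Q / 2 := by gcongr
      _ = volume Q := ENNReal.add_halves _
  have h1 : wMeasure w Q ^ (1 / s) ≤ 2 * C * wMeasure w (Q \ E) ^ (1 / s) := by
    have h2 : volume Q / 2 * wMeasure w Q ^ (1 / s) ≤
        volume Q / 2 * (2 * C * wMeasure w (Q \ E) ^ (1 / s)) := by
      calc volume Q / 2 * wMeasure w Q ^ (1 / s)
          ≤ volume (Q \ E) * wMeasure w Q ^ (1 / s) := by gcongr
        _ ≤ C * volume Q * wMeasure w (Q \ E) ^ (1 / s) := hF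
        _ = C * (volume Q / 2 * 2) * wMeasure w (Q \ E) ^ (1 / s) := by
          rw [ENNReal.div_mul_cancel (by norm_num) (by norm_num)]
        _ = volume Q / 2 * (2 * C * wMeasure w (Q \ E) ^ (1 / s)) := by ring
    exact (ENNReal.mul_le_mul_iff_right (ENNReal.div_pos hV0 (by norm_num)).ne'
      (ENNReal.div_ne_top hVt (by norm_num))).1 h2
  have h3 : wMeasure w Q ≤ K * wMeasure w (Q \ E) := by
    have := ENNReal.rpow_le_rpow h1 hs0.le
    rw [ENNReal.mul_rpow_of_nonneg _ _ hs0.le, ← ENNReal.rpow_mul, ← ENNReal.rpow_mul,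
      one_div_mul_cancel hs0.ne', ENNReal.rpow_one, ENNReal.rpow_one] at this
    refine this.trans ?_
    gcongr
    rw [ENNReal.coe_add, ENNReal.coe_rpow_of_nonneg _ hs0.le]
    push_cast
    exact le_self_add
  have hFt : wMeasure w (Q \ E) ≠ ∞ := ne_top_of_le_ne_top hQt (measure_mono sdiff_subset)
  have h4 : (K : ℝ≥0∞)⁻¹ * wMeasure w Q ≤ wMeasure w (Q \ E) := by
    rw [ENNReal.inv_mul_le_iff (by simpa using hK0.ne') (by simp)]
    exact h3
  rw [ENNReal.coe_sub, ENNReal.coe_one, ENNReal.coe_inv hK0.ne', ENNReal.sub_mul (by simp [hQt]),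
    one_mul]
  refine ENNReal.le_sub_of_add_le_right (ENNReal.mul_ne_top (by simpa using hK0.ne') hQt) ?_
  rw [← hadd]
  gcongr
  rw [hadd]
  exact h4

theorem IsMuckenhouptInfty.doubling {w : EuclideanSpace ℝ (Fin n) → ℝ}
    (hw : IsWeight w) (hwA : IsMuckenhouptInfty w) :
    ∃ C : ℝ≥0, ∀ (x : EuclideanSpace ℝ (Fin n)) (ℓ : ℝ), 0 < ℓ →
      wMeasure w (cube x (2 * ℓ)) ≤ C * wMeasure w (cube x ℓ) := by
  obtain ⟨s, hs, hA⟩ := hwA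
  obtain ⟨C, hC⟩ := hA.volume_mul_le hs hw
  have hs0 : 0 < s := by linarith
  refine ⟨(C * 2 ^ n) ^ s, fun x ℓ hℓ => ?_⟩
  have h := hC x (2 * ℓ) (by linarith) (cube x ℓ) (cube_subset_cube x (by linarith))
    (measurableSet_cube x ℓ)
  have h1 : wMeasure w (cube x (2 * ℓ)) ^ (1 / s) ≤
      C * 2 ^ n * wMeasure w (cube x ℓ) ^ (1 / s) := by
    refine (ENNReal.mul_le_mul_iff_right (volume_cube_ne_zero x hℓ)
      (volume_cube_ne_top x ℓ)).1 (h.trans_eq ?_)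
    rw [volume_cube, volume_cube, ENNReal.ofReal_mul (by norm_num), mul_pow, ENNReal.ofReal_ofNat]
    ring
  have := ENNReal.rpow_le_rpow h1 hs0.le
  rw [ENNReal.mul_rpow_of_nonneg _ _ hs0.le, ← ENNReal.rpow_mul, ← ENNReal.rpow_mul,
    one_div_mul_cancel hs0.ne', ENNReal.rpow_one, ENNReal.rpow_one] at this
  refine this.trans_eq ?_
  rw [ENNReal.coe_rpow_of_nonneg _ hs0.le]
  push_cast
  rfl

/-- In dimension at least one, a cube fills at most half the volume of its double; iterating the
decay over `j` doublings gives the power of `η`. -/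
theorem HalfDecay.cube_le {η : ℝ≥0} {w : EuclideanSpace ℝ (Fin n) → ℝ}
    (h : HalfDecay η (wMeasure w)) (hn : 0 < n) (x : EuclideanSpace ℝ (Fin n)) {ℓ : ℝ}
    (hℓ : 0 < ℓ) (j : ℕ) :
    wMeasure w (cube x ℓ) ≤ η ^ j * wMeasure w (cube x (2 ^ j * ℓ)) := by
  induction j with
  | zero => simp
  | succ j ih =>
    refine ih.trans ?_
    rw [pow_succ, mul_assoc]
    gcongr
    rw [pow_succ', mul_assoc]
    have hpos : 0 < 2 ^ j * ℓ := by positivity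
    refine h x _ (by positivity) _ (cube_subset_cube x (by linarith)) (measurableSet_cube _ _) ?_
    rw [volume_cube, volume_cube, ENNReal.ofReal_mul (by norm_num : (0 : ℝ) ≤ 2), mul_pow,
      ENNReal.ofReal_ofNat]
    obtain ⟨m, rfl⟩ : ∃ m, n = m + 1 := ⟨n - 1, by omega⟩
    rw [ENNReal.le_div_iff_mul_le (by simp) (by simp), mul_comm]
    gcongr
    rw [pow_succ]
    exact le_mul_of_one_le_left' (one_le_pow_of_one_le' (by norm_num) _)

/-! ### Dyadic boxes and the Calderón–Zygmund decomposition. -/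

/-- The index of the dyadic box of generation `m` containing `x`, relative to the initial box with
lower corner `a` and side length `ℓ`. -/
def dyadicIndex (a : Fin n → ℝ) (ℓ : ℝ) (m : ℕ) (x : EuclideanSpace ℝ (Fin n)) : Fin n → ℤ :=
  fun i => ⌊(x i - a i) / ℓ * 2 ^ m⌋

/-- The lower corner of the dyadic box of generation `m` and index `v`. -/
def dyadicCorner (a : Fin n → ℝ) (ℓ : ℝ) (m : ℕ) (v : Fin n → ℤ) : Fin n → ℝ :=
  fun i => a i + v i * (ℓ / 2 ^ m)

/-- The dyadic box of generation `m` and index `v`. -/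
def dyadicBox (a : Fin n → ℝ) (ℓ : ℝ) (m : ℕ) (v : Fin n → ℤ) :
    Set (EuclideanSpace ℝ (Fin n)) :=
  box (dyadicCorner a ℓ m v) (ℓ / 2 ^ m)

theorem mem_dyadicBox {a : Fin n → ℝ} {ℓ : ℝ} (hℓ : 0 < ℓ) {m : ℕ} {v : Fin n → ℤ}
    {x : EuclideanSpace ℝ (Fin n)} : x ∈ dyadicBox a ℓ m v ↔ dyadicIndex a ℓ m x = v := by
  simp only [dyadicBox, box, dyadicCorner, dyadicIndex, funext_iff, Int.floor_eq_iff, mem_ofPred_eq]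
  refine forall_congr' fun i => ?_
  have h2 : (0 : ℝ) < 2 ^ m := by positivity
  rw [div_mul_eq_mul_div, le_div_iff₀ hℓ, div_lt_iff₀ hℓ]
  have e : (v i : ℝ) * (ℓ / 2 ^ m) = v i * ℓ / 2 ^ m := by ring
  have e' : (v i : ℝ) * (ℓ / 2 ^ m) + ℓ / 2 ^ m = (v i + 1) * ℓ / 2 ^ m := by ring
  rw [add_assoc, e', e, ← le_sub_iff_add_le', div_le_iff₀ h2, ← sub_lt_iff_lt_add', lt_div_iff₀ h2]

/-- Nestedness of the dyadic grid: a coarser index is the integer quotient of a finer one by a power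
of two. -/
theorem dyadicIndex_congr {a : Fin n → ℝ} {ℓ : ℝ} {m m' : ℕ} (h : m' ≤ m)
    {x z : EuclideanSpace ℝ (Fin n)} (hxz : dyadicIndex a ℓ m x = dyadicIndex a ℓ m z) :
    dyadicIndex a ℓ m' x = dyadicIndex a ℓ m' z := by
  obtain ⟨k, rfl⟩ := Nat.exists_eq_add_of_le h
  have key : ∀ (y : EuclideanSpace ℝ (Fin n)) (i : Fin n),
      dyadicIndex a ℓ m' y i = dyadicIndex a ℓ (m' + k) y i / ((2 ^ k : ℕ) : ℤ) := by
    intro y i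
    rw [dyadicIndex, dyadicIndex, ← Int.floor_div_natCast]
    congr 1
    push_cast
    rw [pow_add]
    field_simp
  funext i
  rw [key, key, hxz]

theorem volume_dyadicBox (a : Fin n → ℝ) (ℓ : ℝ) (m : ℕ) (v : Fin n → ℤ) :
    volume (dyadicBox a ℓ m v) = ENNReal.ofReal (ℓ / 2 ^ m) ^ n := volume_box _ _

/-- Calderón–Zygmund decomposition inside a box, with stopping boxes as corner and side length. -/
theorem exists_calderonZygmund {φ : EuclideanSpace ℝ (Fin n) → ℝ≥0∞} (hφ : AEMeasurable φ volume)
    (a : Fin n → ℝ) {ℓ : ℝ} (hℓ : 0 < ℓ) {t : ℝ≥0∞} (ht : t ≠ ∞)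
    (hφt : ∫⁻ y, φ y ≤ t * ENNReal.ofReal ℓ ^ n) (hφ0 : ∀ y ∉ box a ℓ, φ y = 0) :
    ∃ S : Set ((Fin n → ℝ) × ℝ), S.Countable ∧
      S.PairwiseDisjoint (fun s => box s.1 s.2) ∧
      (∀ s ∈ S, 0 < s.2 ∧ box s.1 s.2 ⊆ box a ℓ ∧
        t * volume (box s.1 s.2) ≤ ∫⁻ y in box s.1 s.2, φ y ∧
        ∫⁻ y in box s.1 s.2, φ y ≤ 2 ^ n * t * volume (box s.1 s.2)) ∧
      ∀ᵐ x ∂volume, x ∉ ⋃ s ∈ S, box s.1 s.2 → φ x ≤ t := by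
  set bad : ℕ → (Fin n → ℤ) → Prop := fun m v =>
    t * volume (dyadicBox a ℓ m v) < ∫⁻ y in dyadicBox a ℓ m v, φ y with hbad
  -- The stopping boxes are the maximal ones on which the average of `φ` exceeds `t`: no ancestor is
  -- bad.
  set Sel : Set (ℕ × (Fin n → ℤ)) := {k | bad k.1 k.2 ∧ ∀ m' < k.1, ∀ x ∈ dyadicBox a ℓ k.1 k.2,
    ¬ bad m' (dyadicIndex a ℓ m' x)} with hSel
  -- Every box of generation zero has volume `ℓ ^ n`, and even the total integral is at most `t ℓ ^
  -- n`. Hence each stopping box has a parent.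
  have hbad0 : ∀ v, ¬ bad 0 v := by
    intro v h
    refine absurd (h.trans_le ((setLIntegral_le_lintegral _ _).trans hφt)) ?_
    simp [volume_dyadicBox]
  have hne : ∀ m v, bad m v → ∃ x ∈ dyadicBox a ℓ m v, x ∈ box a ℓ := by
    intro m v h
    by_contra! hcon
    have : ∫⁻ y in dyadicBox a ℓ m v, φ y = 0 := by
      rw [setLIntegral_congr_fun (s := dyadicBox a ℓ m v) (measurableSet_box _ _) (fun y hy => hφ0 y (hcon y hy))]
      simp
    rw [hbad] at h
    simp [this] at h
  have hbox0 : ∀ x, x ∈ box a ℓ ↔ dyadicIndex a ℓ 0 x = 0 := by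
    intro x
    have : dyadicCorner a ℓ 0 0 = a := by funext i; simp [dyadicCorner]
    rw [← mem_dyadicBox hℓ]
    simp [dyadicBox, this]
  refine ⟨(fun k => (dyadicCorner a ℓ k.1 k.2, ℓ / 2 ^ k.1)) '' Sel,
    (Set.to_countable Sel).image _, ?_, ?_, ?_⟩
  · rintro _ ⟨k, hk, rfl⟩ _ ⟨k', hk', rfl⟩ hne'
    change Disjoint (dyadicBox a ℓ k.1 k.2) (dyadicBox a ℓ k'.1 k'.2)
    rw [Set.disjoint_left]
    intro z hz hz'
    have aux : ∀ k ∈ Sel, ∀ k' ∈ Sel, z ∈ dyadicBox a ℓ k.1 k.2 → z ∈ dyadicBox a ℓ k'.1 k'.2 →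
        ¬ k.1 < k'.1 := by
      intro k hk k' hk' hz hz' hlt
      refine hk'.2 k.1 hlt z hz' ?_
      rw [(mem_dyadicBox hℓ).1 hz]
      exact hk.1
    have h1 : k.1 = k'.1 :=
      le_antisymm (not_lt.1 (aux k' hk' k hk hz' hz)) (not_lt.1 (aux k hk k' hk' hz hz'))
    apply hne'
    have h2 : k.2 = k'.2 := by
      rw [← (mem_dyadicBox hℓ).1 hz, ← (mem_dyadicBox hℓ).1 hz', h1]
    rw [Prod.ext h1 h2]
  · rintro _ ⟨⟨m, v⟩, hk, rfl⟩
    change 0 < ℓ / 2 ^ m ∧ dyadicBox a ℓ m v ⊆ box a ℓ ∧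
        t * volume (dyadicBox a ℓ m v) ≤ ∫⁻ y in dyadicBox a ℓ m v, φ y ∧
        ∫⁻ y in dyadicBox a ℓ m v, φ y ≤ 2 ^ n * t * volume (dyadicBox a ℓ m v)
    obtain ⟨z, hz, hza⟩ := hne m v hk.1
    refine ⟨by positivity, fun x hx => ?_, hk.1.le, ?_⟩
    · rw [hbox0, ← (hbox0 z).1 hza]
      exact dyadicIndex_congr (Nat.zero_le m)
        (((mem_dyadicBox hℓ).1 hx).trans ((mem_dyadicBox hℓ).1 hz).symm)
    · obtain ⟨m', rfl⟩ : ∃ m', m = m' + 1 := by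
        refine ⟨m - 1, ?_⟩
        have : m ≠ 0 := by rintro rfl; exact hbad0 v hk.1
        omega
      -- The parent is not bad and has `2 ^ n` times the volume, which gives the upper bound on the
      -- average.
      have hpar := hk.2 m' (Nat.lt_succ_self m') z hz
      have hsub : dyadicBox a ℓ (m' + 1) v ⊆ dyadicBox a ℓ m' (dyadicIndex a ℓ m' z) := by
        intro x hx
        rw [mem_dyadicBox hℓ]
        exact dyadicIndex_congr (Nat.le_succ m')
          (((mem_dyadicBox hℓ).1 hx).trans ((mem_dyadicBox hℓ).1 hz).symm)
      refine (lintegral_mono_set hsub).trans ((not_lt.1 hpar).trans_eq ?_)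
      rw [volume_dyadicBox, volume_dyadicBox,
        show ℓ / 2 ^ m' = 2 * (ℓ / 2 ^ (m' + 1)) by field_simp; ring,
        ENNReal.ofReal_mul (by norm_num), mul_pow, ENNReal.ofReal_ofNat]
      ring
  · have hfin : ∫⁻ y, φ y ≠ ∞ := ne_top_of_le_ne_top (by finiteness) hφt
    filter_upwards [ae_tendsto_cornerCube hφ hfin] with x hx hxS
    -- A bad box around `x` of least generation would be a stopping box. So all averages around `x`
    -- are at most `t`, and differentiation passes this on to `φ x`.
    have hnb : ∀ m, ¬ bad m (dyadicIndex a ℓ m x) := by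
      classical
      by_contra! hcon
      have hmin := Nat.find_spec hcon
      set m := Nat.find hcon with hm
      refine hxS (mem_biUnion (mem_image_of_mem _
        (show (m, dyadicIndex a ℓ m x) ∈ Sel from ⟨hmin, fun m' hm' z hz => ?_⟩))
        ((mem_dyadicBox hℓ).2 rfl))
      rw [dyadicIndex_congr hm'.le ((mem_dyadicBox hℓ).1 hz)]
      exact Nat.find_min hcon hm'
    have hlim := hx (fun m => dyadicCorner a ℓ m (dyadicIndex a ℓ m x)) (fun m => ℓ / 2 ^ m)
      (fun m => by positivity) ?_ (fun m => box_subset_cornerCube _ _ ((mem_dyadicBox hℓ).2 rfl))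
    · refine le_of_tendsto' hlim fun m => ?_
      rw [← setLIntegral_congr (box_ae_eq_cornerCube _ _),
        ← measure_congr (box_ae_eq_cornerCube _ _)]
      exact ENNReal.div_le_of_le_mul (not_lt.1 (hnb m))
    · have := (tendsto_pow_atTop_nhds_zero_of_lt_one (r := (1 / 2 : ℝ)) (by norm_num)
        (by norm_num)).const_mul ℓ
      simpa [div_eq_mul_inv] using this

/-! ### Bounded mean oscillation and John–Nirenberg inequalities. -/

/-- The average of `b` over the cube `Q(x, ℓ)`. -/
def cubeAverage (b : EuclideanSpace ℝ (Fin n) → 𝕜) (x : EuclideanSpace ℝ (Fin n)) (ℓ : ℝ) : 𝕜 :=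
  ⨍ z in cube x ℓ, b z

theorem IsBMO.integrableOn_cube {b : EuclideanSpace ℝ (Fin n) → 𝕜} (hb : IsBMO b)
    (x : EuclideanSpace ℝ (Fin n)) {ℓ : ℝ} (hℓ : 0 < ℓ) : IntegrableOn b (cube x ℓ) :=
  hb.1.integrableOn_isCompact (isCompact_cube x hℓ.le)

theorem enorm_setAverage_sub_le {b : EuclideanSpace ℝ (Fin n) → 𝕜}
    {A : Set (EuclideanSpace ℝ (Fin n))} (hb : IntegrableOn b A) (h0 : volume A ≠ 0)
    (ht : volume A ≠ ∞) (c : 𝕜) :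
    ‖(⨍ y in A, b y) - c‖ₑ ≤ (∫⁻ y in A, ‖b y - c‖ₑ) / volume A := by
  have hA : 0 < (volume A).toReal := ENNReal.toReal_pos h0 ht
  have h1 : (⨍ y in A, b y) - c = (volume A).toReal⁻¹ • ∫ y in A, (b y - c) := by
    rw [setAverage_eq, integral_sub hb (integrableOn_const ht), setIntegral_const, smul_sub,
      measureReal_def, inv_smul_smul₀ hA.ne']
  rw [h1, enorm_smul, ENNReal.div_eq_inv_mul]
  gcongr
  · rw [Real.enorm_eq_ofReal (by positivity), ENNReal.ofReal_inv_of_pos hA,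
      ENNReal.ofReal_toReal ht]
  · exact enorm_integral_le_lintegral_enorm _

theorem IsBMO.exists_lintegral_le {b : EuclideanSpace ℝ (Fin n) → 𝕜} (hb : IsBMO b) :
    ∃ M : ℝ≥0, 0 < M ∧ ∀ (x : EuclideanSpace ℝ (Fin n)) (ℓ : ℝ), 0 < ℓ →
      ∫⁻ y in cube x ℓ, ‖b y - cubeAverage b x ℓ‖ₑ ≤ M * volume (cube x ℓ) := by
  obtain ⟨hloc, M, hM⟩ := hb
  refine ⟨M.toNNReal + 1, by positivity, fun x ℓ hℓ => ?_⟩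
  have hV0 := volume_cube_ne_zero x hℓ
  have hVt := volume_cube_ne_top x ℓ
  have hV : 0 < (volume (cube x ℓ)).toReal := ENNReal.toReal_pos hV0 hVt
  have hint : IntegrableOn (fun y => b y - cubeAverage b x ℓ) (cube x ℓ) :=
    (IsBMO.integrableOn_cube ⟨hloc, M, hM⟩ x hℓ).sub (integrableOn_const hVt)
  have h := hM x ℓ hℓ
  rw [setAverage_eq, smul_eq_mul, measureReal_def, inv_mul_le_iff₀ hV] at h
  rw [← ofReal_integral_norm_eq_lintegral_enorm hint]
  refine (ENNReal.ofReal_le_ofReal h).trans ?_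
  rw [ENNReal.ofReal_mul hV.le, ENNReal.ofReal_toReal hVt, mul_comm]
  gcongr
  push_cast
  exact le_self_add

/-- Induction on `k`, stopping `|b - c|` at height `2M`, where `c` is the average over the cube. The
stopping boxes fill at most half the volume, hence carry at most the fraction `η` of `ω`. Off them
`|b - c| ≤ 2M < Λ`; on each the average moves by at most `2^n · 2M ≤ Λ`, so exceeding `(k+1)Λ`
relative to `c` means exceeding `kΛ` relative to the new average. The value `Λ = (2^n + 1) · 2M`
serves both purposes. -/
theorem HalfDecay.measure_oscillation_le {b : EuclideanSpace ℝ (Fin n) → 𝕜}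
    (hb : LocallyIntegrable b volume) {M : ℝ≥0} (hM0 : 0 < M)
    (hM : ∀ (x : EuclideanSpace ℝ (Fin n)) (ℓ : ℝ), 0 < ℓ →
      ∫⁻ y in cube x ℓ, ‖b y - cubeAverage b x ℓ‖ₑ ≤ M * volume (cube x ℓ))
    {η : ℝ≥0} {ω : Measure (EuclideanSpace ℝ (Fin n))} (hω : ω ≪ volume) (hη : HalfDecay η ω)
    (k : ℕ) (x : EuclideanSpace ℝ (Fin n)) {ℓ : ℝ} (hℓ : 0 < ℓ) :
    ω {y ∈ cube x ℓ | k * ((2 ^ n + 1) * (2 * M : ℝ)) ≤ ‖b y - cubeAverage b x ℓ‖} ≤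
      η ^ k * ω (cube x ℓ) := by
  set Λ : ℝ := (2 ^ n + 1) * (2 * M) with hΛ
  induction k generalizing x ℓ with
  | zero => simp
  | succ k ih =>
    set c := cubeAverage b x ℓ
    set a : Fin n → ℝ := fun i => x i - ℓ / 2
    have hQa : cube x ℓ = cornerCube a ℓ := cube_eq_cornerCube x ℓ
    set φ : EuclideanSpace ℝ (Fin n) → ℝ≥0∞ := (box a ℓ).indicator fun y => ‖b y - c‖ₑ with hφ
    have hφm : AEMeasurable φ volume :=
      (hb.aestronglyMeasurable.sub aestronglyMeasurable_const).enorm.indicator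
        (measurableSet_box a ℓ)
    have hφint : ∫⁻ y, φ y ≤ M * volume (cube x ℓ) := by
      rw [lintegral_indicator (measurableSet_box a ℓ),
        setLIntegral_congr (box_ae_eq_cornerCube a ℓ), ← hQa]
      exact hM x ℓ hℓ
    have h2M : (2 * M : ℝ≥0∞) ≠ 0 := by simpa using hM0.ne'
    have h2Mt : (2 * M : ℝ≥0∞) ≠ ∞ := by finiteness
    obtain ⟨S, hSc, hSd, hS, hSae⟩ := exists_calderonZygmund hφm a hℓ (t := 2 * M) h2Mt
      (hφint.trans (by
        rw [volume_cube, mul_assoc]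
        exact le_mul_of_one_le_left' (by norm_num)))
      (fun y hy => indicator_of_notMem hy _)
    set E := ⋃ s ∈ S, box s.1 s.2
    have hEm : MeasurableSet E := MeasurableSet.biUnion hSc fun s _ => measurableSet_box _ _
    have hEQ : E ⊆ cube x ℓ := by
      rw [hQa]
      exact iUnion₂_subset fun s hs => (hS s hs).2.1.trans (box_subset_cornerCube a ℓ)
    have hEvol : volume E ≤ volume (cube x ℓ) / 2 := by
      have h1 : 2 * M * volume E ≤ M * volume (cube x ℓ) := by
        calc 2 * M * volume E = ∑' s : S, 2 * M * volume (box s.1.1 s.1.2) := by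
              rw [measure_biUnion hSc hSd fun s _ => measurableSet_box _ _, ENNReal.tsum_mul_left]
          _ ≤ ∑' s : S, ∫⁻ y in box s.1.1 s.1.2, φ y :=
              ENNReal.tsum_le_tsum fun s => (hS s s.2).2.2.1
          _ = ∫⁻ y in E, φ y :=
              (lintegral_biUnion hSc (fun s _ => measurableSet_box _ _) hSd _).symm
          _ ≤ ∫⁻ y, φ y := setLIntegral_le_lintegral _ _
          _ ≤ _ := hφint
      rw [ENNReal.le_div_iff_mul_le (by simp) (by simp)]
      refine (ENNReal.mul_le_mul_iff_right (a := (M : ℝ≥0∞)) (by simpa using hM0.ne') (by simp)).1 ?_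
      calc (M : ℝ≥0∞) * (volume E * 2) = 2 * M * volume E := by ring
        _ ≤ _ := h1
    have hsub : {y ∈ cube x ℓ | ((k + 1 : ℕ) : ℝ) * Λ ≤ ‖b y - c‖} ≤ᵐ[volume]
        (⋃ s ∈ S, {y ∈ cornerCube s.1 s.2 | k * Λ ≤ ‖b y - cubeAverage b
          (WithLp.toLp 2 fun i => s.1 i + s.2 / 2) s.2‖} : Set _) := by
      filter_upwards [hSae, box_ae_eq_cornerCube a ℓ] with y hy hyQ hyL
      obtain ⟨hyc, hyΛ⟩ := hyL
      have hybox : y ∈ box a ℓ := by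
        rw [hQa] at hyc
        exact hyQ.mpr hyc
      have hyE : y ∈ E := by
        by_contra hcon
        have h1 := hy hcon
        rw [hφ, indicator_of_mem hybox] at h1
        have h2 : ‖b y - c‖ ≤ 2 * M := by
          rw [← ofReal_norm] at h1
          have := ENNReal.toReal_mono h2Mt h1
          simpa using this
        have h3 : Λ ≤ ‖b y - c‖ := by
          refine le_trans ?_ hyΛ
          push_cast
          have : 0 ≤ (k : ℝ) * Λ := by positivity
          linarith
        have h4 : (2 * M : ℝ) < Λ := by
          rw [hΛ]
          have : (0 : ℝ) < 2 ^ n * (2 * M) := by positivity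
          linarith
        linarith
      obtain ⟨s, hs, hys⟩ := mem_iUnion₂.1 hyE
      obtain ⟨hs0, hsa, -, hsφ⟩ := hS s hs
      refine mem_biUnion hs ⟨box_subset_cornerCube _ _ hys, ?_⟩
      set cs := cubeAverage b (WithLp.toLp 2 fun i => s.1 i + s.2 / 2) s.2 with hcs
      have h5 : ‖cs - c‖ₑ ≤ 2 ^ n * (2 * M) := by
        rw [hcs, cubeAverage]
        refine (enorm_setAverage_sub_le (hb.integrableOn_isCompact (isCompact_cube _ hs0.le))
          (volume_cube_ne_zero _ hs0) (volume_cube_ne_top _ _) c).trans ?_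
        refine ENNReal.div_le_of_le_mul ?_
        have h6 := box_ae_eq_cornerCube s.1 s.2
        rw [measure_congr h6] at hsφ
        refine le_trans (le_of_eq ?_) hsφ
        change ∫⁻ y in cornerCube s.1 s.2, _ = _
        rw [← setLIntegral_congr h6]
        exact setLIntegral_congr_fun (measurableSet_box _ _) fun z hz =>
          (indicator_of_mem (hsa hz) fun y => ‖b y - c‖ₑ).symm
      have h7 : ‖cs - c‖ ≤ Λ := by
        rw [← ofReal_norm] at h5
        have := ENNReal.toReal_mono (by finiteness) h5
        simp at this
        rw [hΛ]
        have : (0 : ℝ) < M := hM0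
        linarith
      have h8 : ‖b y - c‖ ≤ ‖b y - cs‖ + ‖cs - c‖ := norm_sub_le_norm_sub_add_norm_sub _ _ _
      push_cast at hyΛ
      linarith
    calc ω {y ∈ cube x ℓ | ((k + 1 : ℕ) : ℝ) * Λ ≤ ‖b y - c‖}
        ≤ ω (⋃ s ∈ S, {y ∈ cornerCube s.1 s.2 | k * Λ ≤ ‖b y - cubeAverage b
          (WithLp.toLp 2 fun i => s.1 i + s.2 / 2) s.2‖}) := measure_mono_ae (hω.ae_le hsub)
      _ ≤ ∑' s : S, ω {y ∈ cornerCube s.1.1 s.1.2 | k * Λ ≤ ‖b y - cubeAverage b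
          (WithLp.toLp 2 fun i => s.1.1 i + s.1.2 / 2) s.1.2‖} := measure_biUnion_le _ hSc _
      _ ≤ ∑' s : S, η ^ k * ω (box s.1.1 s.1.2) := by
          refine ENNReal.tsum_le_tsum fun s => ?_
          rw [measure_congr (hω.ae_eq (box_ae_eq_cornerCube s.1.1 s.1.2))]
          exact ih _ (hS s s.2).1
      _ = η ^ k * ω E := by
          rw [measure_biUnion hSc hSd fun s _ => measurableSet_box _ _, ENNReal.tsum_mul_left]
      _ ≤ η ^ k * (η * ω (cube x ℓ)) := by gcongr; exact hη x ℓ hℓ E hEQ hEm hEvol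
      _ = η ^ (k + 1) * ω (cube x ℓ) := by rw [pow_succ]; ring

/-- A weighted John–Nirenberg inequality. -/
theorem IsBMO.johnNirenberg {b : EuclideanSpace ℝ (Fin n) → 𝕜} (hb : IsBMO b) :
    ∃ Λ : ℝ, 0 < Λ ∧ ∀ (η : ℝ≥0) (ω : Measure (EuclideanSpace ℝ (Fin n))), ω ≪ volume →
      HalfDecay η ω → ∀ (k : ℕ) (x : EuclideanSpace ℝ (Fin n)) (ℓ : ℝ), 0 < ℓ →
        ω {y ∈ cube x ℓ | k * Λ ≤ ‖b y - cubeAverage b x ℓ‖} ≤ η ^ k * ω (cube x ℓ) := by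
  obtain ⟨M, hM0, hM⟩ := hb.exists_lintegral_le
  exact ⟨(2 ^ n + 1) * (2 * M), by positivity, fun η ω hω hη k x ℓ hℓ =>
    hη.measure_oscillation_le hb.1 hM0 hM hω k x hℓ⟩

/-- One doubling moves the average by at most `2^n M`, since the small cube has the fraction
`2^{-n}` of the volume; the differences telescope. -/
theorem IsBMO.exists_enorm_cubeAverage_sub_le {b : EuclideanSpace ℝ (Fin n) → 𝕜} (hb : IsBMO b) :
    ∃ M : ℝ≥0, ∀ (x : EuclideanSpace ℝ (Fin n)) (ℓ : ℝ), 0 < ℓ → ∀ j : ℕ,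
      ‖cubeAverage b x ℓ - cubeAverage b x (2 ^ j * ℓ)‖ₑ ≤ M * j := by
  obtain ⟨M, hM0, hM⟩ := hb.exists_lintegral_le
  refine ⟨2 ^ n * M, fun x ℓ hℓ j => ?_⟩
  induction j with
  | zero => simp
  | succ j ih =>
    have hpos : 0 < 2 ^ j * ℓ := by positivity
    have hstep : ‖cubeAverage b x (2 ^ j * ℓ) - cubeAverage b x (2 ^ (j + 1) * ℓ)‖ₑ ≤
        (2 ^ n * M : ℝ≥0) := by
      rw [cubeAverage]
      refine (enorm_setAverage_sub_le (hb.integrableOn_cube x hpos) (volume_cube_ne_zero x hpos)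
        (volume_cube_ne_top _ _) _).trans (ENNReal.div_le_of_le_mul ?_)
      refine (lintegral_mono_set (cube_subset_cube x (ℓ' := 2 ^ (j + 1) * ℓ) ?_)).trans
        ((hM x (2 ^ (j + 1) * ℓ) (by positivity)).trans_eq ?_)
      · rw [pow_succ]; linarith
      · rw [volume_cube, volume_cube, pow_succ', mul_assoc, ENNReal.ofReal_mul (by norm_num),
          mul_pow, ENNReal.ofReal_ofNat]
        push_cast
        ring
    calc ‖cubeAverage b x ℓ - cubeAverage b x (2 ^ (j + 1) * ℓ)‖ₑ
        = ‖(cubeAverage b x ℓ - cubeAverage b x (2 ^ j * ℓ)) +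
            (cubeAverage b x (2 ^ j * ℓ) - cubeAverage b x (2 ^ (j + 1) * ℓ))‖ₑ := by
          rw [sub_add_sub_cancel]
      _ ≤ _ := (enorm_add_le _ _).trans (add_le_add ih hstep)
      _ = _ := by push_cast; ring

/-- Exponential integrability of functions of bounded mean oscillation. -/
theorem IsBMO.exists_lintegral_exp_le {b : EuclideanSpace ℝ (Fin n) → 𝕜} (hb : IsBMO b) :
    ∃ c : ℝ, 0 < c ∧ ∀ (x : EuclideanSpace ℝ (Fin n)) (ℓ : ℝ), 0 < ℓ →
      ∫⁻ y in cube x ℓ, ENNReal.ofReal (Real.exp (c * ‖b y - cubeAverage b x ℓ‖)) ≤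
        4 * volume (cube x ℓ) := by
  obtain ⟨Λ, hΛ, hJN⟩ := hb.johnNirenberg
  -- On the layer where the oscillation is between `kΛ` and `(k+1)Λ`, the exponential is at most
  -- `(4/3)^(k+1)`, against measure decay `2^{-k}`; the geometric series with ratio `2/3` sums to
  -- `4`.
  refine ⟨Real.log (4 / 3) / Λ, div_pos (Real.log_pos (by norm_num)) hΛ, fun x ℓ hℓ => ?_⟩
  have hJN := fun k => hJN (1 / 2) volume Measure.AbsolutelyContinuous.rfl halfDecay_volume k x ℓ hℓ
  set u : EuclideanSpace ℝ (Fin n) → ℝ := fun y => ‖b y - cubeAverage b x ℓ‖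
  set A : ℕ → Set (EuclideanSpace ℝ (Fin n)) := fun k => {y | k * Λ ≤ u y}
  have hum : AEMeasurable u (volume.restrict (cube x ℓ)) :=
    (hb.1.aestronglyMeasurable.sub aestronglyMeasurable_const).norm.aemeasurable.restrict
  have hA : ∀ k, NullMeasurableSet (A k) (volume.restrict (cube x ℓ)) := fun k =>
    nullMeasurableSet_le aemeasurable_const hum
  have hpt : ∀ y, ENNReal.ofReal (Real.exp (Real.log (4 / 3) / Λ * u y)) ≤
      ∑' k : ℕ, (A k).indicator (fun _ => ENNReal.ofReal ((4 / 3) ^ (k + 1))) y := by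
    intro y
    have hu0 : 0 ≤ u y / Λ := div_nonneg (norm_nonneg _) hΛ.le
    refine le_trans ?_ (ENNReal.le_tsum ⌊u y / Λ⌋₊)
    have hmem : y ∈ A ⌊u y / Λ⌋₊ := by
      change _ * Λ ≤ u y
      rw [← le_div_iff₀ hΛ]
      exact Nat.floor_le hu0
    rw [indicator_of_mem hmem]
    refine ENNReal.ofReal_le_ofReal ?_
    have h1 : u y / Λ ≤ (⌊u y / Λ⌋₊ + 1 : ℕ) := by
      push_cast; exact (Nat.lt_floor_add_one _).le
    calc Real.exp (Real.log (4 / 3) / Λ * u y)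
        = Real.exp (Real.log (4 / 3) * (u y / Λ)) := by ring_nf
      _ ≤ Real.exp (Real.log (4 / 3) * (⌊u y / Λ⌋₊ + 1 : ℕ)) := by
          have : 0 ≤ Real.log (4 / 3) := (Real.log_pos (by norm_num)).le
          gcongr
      _ = (4 / 3) ^ (⌊u y / Λ⌋₊ + 1) := by
          rw [mul_comm, Real.exp_nat_mul, Real.exp_log (by norm_num)]
  calc ∫⁻ y in cube x ℓ, ENNReal.ofReal (Real.exp (Real.log (4 / 3) / Λ * u y))
      ≤ ∫⁻ y in cube x ℓ, ∑' k : ℕ,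
          (A k).indicator (fun _ => ENNReal.ofReal ((4 / 3) ^ (k + 1))) y := lintegral_mono hpt
    _ = ∑' k : ℕ, ENNReal.ofReal ((4 / 3) ^ (k + 1)) * volume.restrict (cube x ℓ) (A k) := by
        rw [lintegral_tsum fun k => aemeasurable_const.indicator₀ (hA k)]
        exact tsum_congr fun k => lintegral_indicator_const₀ (hA k) _
    _ ≤ ∑' k : ℕ, ENNReal.ofReal (4 / 3 * (2 / 3) ^ k) * volume (cube x ℓ) := by
        refine ENNReal.tsum_le_tsum fun k => ?_
        have h2 : volume.restrict (cube x ℓ) (A k) ≤ ENNReal.ofReal ((1 / 2) ^ k) *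
            volume (cube x ℓ) := by
          rw [Measure.restrict_apply' (measurableSet_cube x ℓ), inter_comm]
          refine (hJN k).trans_eq ?_
          rw [ENNReal.ofReal_pow (by norm_num)]
          congr 2
          rw [ENNReal.coe_div (by norm_num), ENNReal.ofReal_div_of_pos (by norm_num)]
          simp
        refine (mul_le_mul_right h2 _).trans_eq ?_
        rw [← mul_assoc, ← ENNReal.ofReal_mul (by positivity)]
        congr 2
        rw [pow_succ, show (2 / 3 : ℝ) = 4 / 3 * (1 / 2) by norm_num, mul_pow]
        ring
    _ = 4 * volume (cube x ℓ) := by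
        rw [ENNReal.tsum_mul_right, ← ENNReal.ofReal_tsum_of_nonneg (fun k => by positivity)
          ((summable_geometric_of_lt_one (by norm_num) (by norm_num)).mul_left _), tsum_mul_left,
          tsum_geometric_of_lt_one (by norm_num) (by norm_num)]
        norm_num

/-! ### Generalised Hölder inequality and the estimate on one cube. -/

/-- A Young inequality for the pair `t log t` and `exp`. Either `s ≤ K log(e + t)`, and the first
term dominates, or `t ≤ e^{s/K}`, and with `s ≤ K e^{s/K}` the second does. -/
theorem ofReal_mul_rpow_le_youngLog {p K s : ℝ} (hp : 1 < p) (hK : 0 < K) (hs : 0 ≤ s)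
    (τ : ℝ≥0∞) :
    (ENNReal.ofReal s * τ) ^ Real.conjExponent p ≤
      ENNReal.ofReal K ^ Real.conjExponent p * youngLog p τ +
        ENNReal.ofReal (K * Real.exp (2 * s / K)) ^ Real.conjExponent p := by
  have hP : 0 < Real.conjExponent p := (Real.HolderConjugate.conjExponent hp).symm.pos
  set P := Real.conjExponent p
  rcases eq_or_ne τ ∞ with rfl | hτ
  · have : ENNReal.ofReal K ^ P * youngLog p ∞ = ∞ := by
      rw [youngLog, ENNReal.top_rpow_of_pos hP]
      simp [hK, hP, P]
    rw [this, top_add]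
    exact le_top
  · obtain ⟨t, ht, rfl⟩ : ∃ t : ℝ, 0 ≤ t ∧ τ = ENNReal.ofReal t :=
      ⟨τ.toReal, ENNReal.toReal_nonneg, (ENNReal.ofReal_toReal hτ).symm⟩
    have hlog : 0 ≤ Real.log (Real.exp 1 + t) :=
      Real.log_nonneg (by have := Real.add_one_le_exp 1; linarith)
    by_cases h : s ≤ K * Real.log (Real.exp 1 + t)
    · refine le_add_right ?_
      rw [youngLog, ENNReal.toReal_ofReal ht, ← ENNReal.mul_rpow_of_nonneg _ _ hP.le,
        ← ENNReal.mul_rpow_of_nonneg _ _ hP.le]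
      refine ENNReal.rpow_le_rpow ?_ hP.le
      rw [← ENNReal.ofReal_mul hs, ← ENNReal.ofReal_mul ht, ← ENNReal.ofReal_mul hK.le]
      refine ENNReal.ofReal_le_ofReal ?_
      nlinarith
    · refine le_add_left (ENNReal.rpow_le_rpow ?_ hP.le)
      rw [← ENNReal.ofReal_mul hs]
      refine ENNReal.ofReal_le_ofReal ?_
      rw [not_le, ← lt_div_iff₀' hK, Real.log_lt_iff_lt_exp (by positivity)] at h
      have h1 : t ≤ Real.exp (s / K) := by
        have := Real.exp_pos 1
        linarith
      have h2 : s ≤ K * Real.exp (s / K) := by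
        have := Real.add_one_le_exp (s / K)
        rw [← div_le_iff₀' hK]
        linarith
      calc s * t ≤ K * Real.exp (s / K) * Real.exp (s / K) := by gcongr
        _ = K * Real.exp (2 * s / K) := by
          rw [mul_assoc, ← Real.exp_add]
          ring_nf

/-- Generalised Hölder inequality pairing the exponential class with the `L log L`-type Luxemburg
average. -/
theorem IsBMO.exists_laverage_le_luxemburg {b : EuclideanSpace ℝ (Fin n) → 𝕜} (hb : IsBMO b)
    {p : ℝ} (hp : 1 < p) :
    ∃ C : ℝ≥0, ∀ (g : EuclideanSpace ℝ (Fin n) → ℝ≥0∞) (x : EuclideanSpace ℝ (Fin n)) (ℓ : ℝ),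
      0 < ℓ →
      (⨍⁻ y in cube x ℓ, ((1 + ‖b y - cubeAverage b x ℓ‖ₑ) * g y) ^ Real.conjExponent p ∂volume)
          ^ (1 / Real.conjExponent p) ≤ C * luxemburg (youngLog p) g (cube x ℓ) := by
  obtain ⟨c, hc, hexp⟩ := hb.exists_lintegral_exp_le
  have hP : 0 < Real.conjExponent p := (Real.HolderConjugate.conjExponent hp).symm.pos
  set P := Real.conjExponent p
  -- This choice turns `exp(2s/K)^P` into `exp(c s)`, the exponential known to be integrable; `s = 1
  -- + u` accounts for the factor `exp c` in `C₀`.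
  set K : ℝ := 2 * P / c
  have hK : 0 < K := by positivity
  set C₀ : ℝ≥0 := K.toNNReal ^ P * (1 + (Real.exp c).toNNReal * 4) with hC₀
  have hC₀pos : 0 < C₀ := by
    have : 0 < K.toNNReal := Real.toNNReal_pos.2 hK
    positivity
  refine ⟨C₀ ^ (1 / P), fun g x ℓ hℓ => ?_⟩
  have hV0 := volume_cube_ne_zero x hℓ
  have hVt := volume_cube_ne_top x ℓ
  have hCpos : 0 < C₀ ^ (1 / P) := NNReal.rpow_pos hC₀pos
  rw [luxemburg, ENNReal.mul_iInf_of_ne (by simpa using hCpos.ne') (by simp)]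
  refine le_iInf fun t => ?_
  rw [ENNReal.mul_iInf_of_ne (by simpa using hCpos.ne') (by simp)]
  refine le_iInf fun ⟨ht, hadm⟩ => ?_
  set T := ENNReal.ofReal t
  have hT0 : T ≠ 0 := by simpa [T] using ht
  have hTt : T ≠ ∞ := ENNReal.ofReal_ne_top
  set u : EuclideanSpace ℝ (Fin n) → ℝ := fun y => ‖b y - cubeAverage b x ℓ‖
  have hum : AEMeasurable u volume :=
    (hb.1.aestronglyMeasurable.sub aestronglyMeasurable_const).norm.aemeasurable
  have hpt : ∀ y, ((1 + ‖b y - cubeAverage b x ℓ‖ₑ) * g y) ^ P ≤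
      T ^ P * (ENNReal.ofReal K ^ P * ENNReal.ofReal (Real.exp c) *
        ENNReal.ofReal (Real.exp (c * u y)) + ENNReal.ofReal K ^ P * youngLog p (g y / T)) := by
    intro y
    have h1 : (1 + ‖b y - cubeAverage b x ℓ‖ₑ) * g y = T * (ENNReal.ofReal (1 + u y) * (g y / T)) := by
      rw [ENNReal.ofReal_add zero_le_one (norm_nonneg _), ENNReal.ofReal_one, ofReal_norm,
        mul_left_comm, ENNReal.mul_div_cancel hT0 hTt]
    rw [h1, ENNReal.mul_rpow_of_nonneg _ _ hP.le]
    gcongr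
    refine (ofReal_mul_rpow_le_youngLog hp hK (by positivity) _).trans_eq ?_
    rw [add_comm]
    congr 1
    rw [mul_assoc, ← ENNReal.ofReal_mul (Real.exp_nonneg _), ← Real.exp_add,
      ENNReal.ofReal_mul hK.le, ENNReal.mul_rpow_of_nonneg _ _ hP.le]
    congr 1
    rw [ENNReal.ofReal_rpow_of_pos (Real.exp_pos _), ← Real.exp_mul]
    congr 2
    simp only [K]
    field_simp
  have hmain : ⨍⁻ y in cube x ℓ, ((1 + ‖b y - cubeAverage b x ℓ‖ₑ) * g y) ^ P ∂volume ≤ T ^ P * C₀ := by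
    rw [setLAverage_eq] at hadm ⊢
    have hadm' := (ENNReal.div_le_iff hV0 hVt).1 hadm
    refine ENNReal.div_le_of_le_mul ((lintegral_mono hpt).trans ?_)
    rw [lintegral_const_mul' _ _ (by finiteness), lintegral_add_left', lintegral_const_mul' _ _
      (by finiteness), lintegral_const_mul' _ _ (by finiteness), mul_assoc (T ^ P) (C₀ : ℝ≥0∞)]
    · gcongr
      calc _ ≤ ENNReal.ofReal K ^ P * ENNReal.ofReal (Real.exp c) * (4 * volume (cube x ℓ)) +
            ENNReal.ofReal K ^ P * (1 * volume (cube x ℓ)) := by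
            gcongr
            exact hexp x ℓ hℓ
        _ = C₀ * volume (cube x ℓ) := by
            rw [hC₀]
            push_cast
            rw [ENNReal.coe_rpow_of_nonneg _ hP.le]
            simp only [ENNReal.ofReal]
            ring
    · exact (Real.measurable_exp.comp_aemeasurable
        (hum.const_mul c)).ennreal_ofReal.const_mul _ |>.restrict
  calc _ ≤ (T ^ P * C₀) ^ (1 / P) := ENNReal.rpow_le_rpow hmain (by positivity)
    _ = (C₀ ^ (1 / P) : ℝ≥0) * T := by
      rw [ENNReal.mul_rpow_of_nonneg _ _ (by positivity), ← ENNReal.rpow_mul,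
        mul_one_div_cancel hP.ne', ENNReal.rpow_one, ENNReal.coe_rpow_of_nonneg _ (by positivity),
        mul_comm]

/-- Monotonicity of power means on the normalised cube; only the plain average of `w` is needed
below, and the bump with `r > 1` dominates it. -/
theorem laverage_rpow_le {w : EuclideanSpace ℝ (Fin n) → ℝ} (hw : IsWeight w) {p r : ℝ}
    (hp : 1 < p) (hr : 1 < r) (x : EuclideanSpace ℝ (Fin n)) {ℓ : ℝ} (hℓ : 0 < ℓ) :
    (wMeasure w (cube x ℓ) / volume (cube x ℓ)) ^ (1 / p) ≤
      (⨍⁻ y in cube x ℓ, ENNReal.ofReal (w y) ^ r ∂volume) ^ (1 / (r * p)) := by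
  have hV0 := volume_cube_ne_zero x hℓ
  have hVt := volume_cube_ne_top x ℓ
  have hg : AEStronglyMeasurable (fun y => ENNReal.ofReal (w y)) (volume.restrict (cube x ℓ)) :=
    hw.aemeasurable.ennreal_ofReal.restrict.aestronglyMeasurable
  have : NeZero (volume.restrict (cube x ℓ)) := ⟨by simpa [Measure.restrict_eq_zero] using hV0⟩
  have : IsFiniteMeasure (volume.restrict (cube x ℓ)) := ⟨by simpa using hVt.lt_top⟩
  have h := eLpNorm'_le_eLpNorm'_of_exponent_le (p := 1) (q := r) one_pos hr.le
    ((volume.restrict (cube x ℓ) univ)⁻¹ • volume.restrict (cube x ℓ)) (hg.smul_measure _)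
  simp only [eLpNorm', enorm_eq_self, ENNReal.rpow_one, one_div_one] at h
  have h' := ENNReal.rpow_le_rpow h (show 0 ≤ 1 / p by positivity)
  rw [← ENNReal.rpow_mul] at h'
  convert h' using 1
  · rw [wMeasure_cube, ← setLAverage_eq]
    rfl
  · rw [show 1 / (r * p) = 1 / r * (1 / p) by field_simp]
    rfl

/-- The basic estimate for one cube. -/
theorem BumpCondition.exists_lintegral_le {b : EuclideanSpace ℝ (Fin n) → 𝕜} (hb : IsBMO b)
    {γ p r : ℝ} (hp : 1 < p) (hr : 1 < r) {w ν : EuclideanSpace ℝ (Fin n) → ℝ} (hw : IsWeight w)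
    (hν : IsWeight ν) (hwν : BumpCondition γ p r w ν) :
    ∃ C : ℝ≥0, ∀ f : EuclideanSpace ℝ (Fin n) → 𝕜, AEStronglyMeasurable f volume →
      ∀ (x : EuclideanSpace ℝ (Fin n)) (ℓ : ℝ), 0 < ℓ →
      wMeasure w (cube x ℓ) ^ (1 / p) * (volume (cube x ℓ) ^ (γ / n - 1) *
        ∫⁻ y in cube x ℓ, (1 + ‖b y - cubeAverage b x ℓ‖ₑ) * ‖f y‖ₑ) ≤
      C * (∫⁻ y in cube x ℓ, ‖f y‖ₑ ^ p * ENNReal.ofReal (ν y)) ^ (1 / p) := by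
  obtain ⟨C₁, hC₁⟩ := hwν
  obtain ⟨C₂, hC₂⟩ := hb.exists_laverage_le_luxemburg hp
  refine ⟨C₁ * C₂, fun f hf x ℓ hℓ => ?_⟩
  have hconj : p.HolderConjugate (Real.conjExponent p) := Real.HolderConjugate.conjExponent hp
  have hC₁ := hC₁ x ℓ hℓ
  have hC₂ := hC₂ (fun y => ENNReal.ofReal (ν y) ^ (-(1 / p))) x ℓ hℓ
  have hP : 0 < Real.conjExponent p := hconj.symm.pos
  set P := Real.conjExponent p
  have hp0 : 0 < p := by linarith
  have hV0 := volume_cube_ne_zero x hℓ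
  have hVt := volume_cube_ne_top x ℓ
  have hWt := hw.wMeasure_cube_ne_top x hℓ.le
  have hJen := laverage_rpow_le hw hp hr x hℓ
  set V := volume (cube x ℓ)
  set W := wMeasure w (cube x ℓ)
  set L := luxemburg (youngLog p) (fun y => ENNReal.ofReal (ν y) ^ (-(1 / p))) (cube x ℓ)
  set h : EuclideanSpace ℝ (Fin n) → ℝ≥0∞ := fun y =>
    (1 + ‖b y - cubeAverage b x ℓ‖ₑ) * ENNReal.ofReal (ν y) ^ (-(1 / p)) with hh
  have hνm : AEMeasurable (fun y => ENNReal.ofReal (ν y)) volume := hν.aemeasurable.ennreal_ofReal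
  have hhm : AEMeasurable h volume :=
    ((hb.1.aestronglyMeasurable.sub aestronglyMeasurable_const).enorm.const_add 1).mul
      (hνm.pow_const _)
  rw [setLAverage_eq] at hC₂
  set J := ∫⁻ y in cube x ℓ, h y ^ P
  rcases eq_or_ne W 0 with hW0 | hW0
  · rw [hW0, ENNReal.zero_rpow_of_pos (by positivity)]; simp
  have hbound : V ^ (γ / n) * (W / V) ^ (1 / p) * (J / V) ^ (1 / P) ≤ C₁ * C₂ := by
    calc V ^ (γ / n) * (W / V) ^ (1 / p) * (J / V) ^ (1 / P)
        ≤ V ^ (γ / n) * (⨍⁻ y in cube x ℓ, ENNReal.ofReal (w y) ^ r ∂volume) ^ (1 / (r * p)) *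
            (C₂ * L) := by gcongr
      _ = (V ^ (γ / n) * (⨍⁻ y in cube x ℓ, ENNReal.ofReal (w y) ^ r ∂volume) ^ (1 / (r * p)) * L) *
            C₂ := by ring
      _ ≤ C₁ * C₂ := by gcongr
  have hVr0 : ∀ a : ℝ, V ^ a ≠ 0 := fun a => (ENNReal.rpow_pos (pos_iff_ne_zero.2 hV0) hVt).ne'
  have hVrt : ∀ a : ℝ, V ^ a ≠ ∞ := fun a => ENNReal.rpow_ne_top_of_ne_zero hV0 hVt
  -- With `W` positive, an infinite `J` would contradict the bump condition. Consequently `ν > 0`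
  -- almost everywhere on the cube, and `f` may be written as `f ν^{1/p} · ν^{-1/p}` for Hölder.
  have hJt : J ≠ ∞ := by
    intro hJ
    rw [hJ, ENNReal.top_div_of_ne_top hVt, ENNReal.top_rpow_of_pos (by positivity),
      ENNReal.mul_top] at hbound
    · exact absurd hbound (not_le.2 (by finiteness))
    · refine mul_ne_zero (hVr0 _) (ENNReal.rpow_pos (ENNReal.div_pos hW0 hVt)
        (ENNReal.div_ne_top hWt hV0)).ne'
  have hae : ∀ᵐ y ∂(volume.restrict (cube x ℓ)), h y ^ P < ∞ :=
    ae_lt_top' (hhm.restrict.pow_const _) hJt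
  have hHold : ∫⁻ y in cube x ℓ, (1 + ‖b y - cubeAverage b x ℓ‖ₑ) * ‖f y‖ₑ ≤
      (∫⁻ y in cube x ℓ, ‖f y‖ₑ ^ p * ENNReal.ofReal (ν y)) ^ (1 / p) * J ^ (1 / P) := by
    calc ∫⁻ y in cube x ℓ, (1 + ‖b y - cubeAverage b x ℓ‖ₑ) * ‖f y‖ₑ
        = ∫⁻ y in cube x ℓ, ((fun y => ‖f y‖ₑ * ENNReal.ofReal (ν y) ^ (1 / p)) * h) y := by
          refine lintegral_congr_ae ?_
          filter_upwards [hae] with y hy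
          have hy0 : ENNReal.ofReal (ν y) ≠ 0 := by
            intro h0
            rw [hh] at hy
            simp only [h0] at hy
            rw [ENNReal.zero_rpow_of_neg (by simpa using hp0), ENNReal.mul_top (by simp),
              ENNReal.top_rpow_of_pos hP] at hy
            exact lt_irrefl _ hy
          rw [Pi.mul_apply, hh]
          have e : ENNReal.ofReal (ν y) ^ (1 / p) * ENNReal.ofReal (ν y) ^ (-(1 / p)) = 1 := by
            rw [← ENNReal.rpow_add _ _ hy0 ENNReal.ofReal_ne_top]
            simp
          calc (1 + ‖b y - cubeAverage b x ℓ‖ₑ) * ‖f y‖ₑ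
              = ‖f y‖ₑ * (1 + ‖b y - cubeAverage b x ℓ‖ₑ) *
                (ENNReal.ofReal (ν y) ^ (1 / p) * ENNReal.ofReal (ν y) ^ (-(1 / p))) := by
                rw [e]; ring
            _ = _ := by ring
      _ ≤ (∫⁻ y in cube x ℓ, (‖f y‖ₑ * ENNReal.ofReal (ν y) ^ (1 / p)) ^ p) ^ (1 / p) *
            J ^ (1 / P) :=
        ENNReal.lintegral_mul_le_Lp_mul_Lq _ hconj
          (hf.enorm.mul (hνm.pow_const _)).restrict hhm.restrict
      _ = _ := by
        congr 3
        ext y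
        rw [ENNReal.mul_rpow_of_nonneg _ _ hp0.le, ← ENNReal.rpow_mul, one_div_mul_cancel hp0.ne',
          ENNReal.rpow_one]
  set N := (∫⁻ y in cube x ℓ, ‖f y‖ₑ ^ p * ENNReal.ofReal (ν y)) ^ (1 / p)
  have hcomb : W ^ (1 / p) * (V ^ (γ / n - 1) * J ^ (1 / P)) =
      V ^ (γ / n) * (W / V) ^ (1 / p) * (J / V) ^ (1 / P) := by
    rw [ENNReal.div_rpow_of_nonneg _ _ (by positivity),
      ENNReal.div_rpow_of_nonneg _ _ (by positivity)]
    rw [div_eq_mul_inv (W ^ (1 / p)), div_eq_mul_inv (J ^ (1 / P)), ← ENNReal.rpow_neg,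
      ← ENNReal.rpow_neg]
    have : V ^ (γ / n - 1) = V ^ (γ / n) * (V ^ (-(1 / p)) * V ^ (-(1 / P))) := by
      rw [← ENNReal.rpow_add _ _ hV0 hVt, ← ENNReal.rpow_add _ _ hV0 hVt]
      congr 1
      have := hconj.inv_add_inv_eq_one
      simp only [one_div]
      linarith
    rw [this]
    ring
  calc W ^ (1 / p) * (V ^ (γ / n - 1) *
        ∫⁻ y in cube x ℓ, (1 + ‖b y - cubeAverage b x ℓ‖ₑ) * ‖f y‖ₑ)
      ≤ W ^ (1 / p) * (V ^ (γ / n - 1) * (N * J ^ (1 / P))) := by gcongr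
    _ = W ^ (1 / p) * (V ^ (γ / n - 1) * J ^ (1 / P)) * N := by ring
    _ ≤ (C₁ * C₂ : ℝ≥0) * N := by
      rw [hcomb]
      push_cast
      gcongr

/-! ### The far part of the function. -/

/-- Some coordinate of `z - y` exceeds `2^j ℓ`, while that of `x - y` is at most `ℓ/2 ≤ 2^j ℓ/2`;
the difference is at least `2^j ℓ/2`, which is one eighth of the side of the next cube. -/
theorem le_norm_sub_of_notMem_cube {x y z : EuclideanSpace ℝ (Fin n)} {ℓ : ℝ} {j : ℕ}
    (hℓ : 0 < ℓ) (hx : x ∈ cube y ℓ) (hz : z ∉ cube y (2 ^ (j + 1) * ℓ)) :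
    2 ^ (j + 2) * ℓ / 8 ≤ ‖x - z‖ := by
  simp only [cube, mem_ofPred_eq, not_forall, not_le] at hx hz
  obtain ⟨i, hi⟩ := hz
  refine le_trans ?_ (abs_apply_le_norm (x - z) i)
  have h1 := hx i
  have h2 : |z i - y i| ≤ |x i - y i| + |x i - z i| := by
    rw [abs_sub_comm (x i) (z i), add_comm]
    exact abs_sub_le _ _ _
  have h3 : (1 : ℝ) ≤ 2 ^ j := one_le_pow₀ (by norm_num)
  change _ ≤ |x i - z i|
  rw [pow_succ] at hi
  rw [pow_add]
  nlinarith

theorem exists_mem_cube (y z : EuclideanSpace ℝ (Fin n)) {ℓ : ℝ} (hℓ : 0 < ℓ) :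
    ∃ j : ℕ, z ∈ cube y (2 ^ (j + 1) * ℓ) := by
  obtain ⟨j, hj⟩ := pow_unbounded_of_one_lt (‖z - y‖ / ℓ) (one_lt_two (α := ℝ))
  refine ⟨j, fun i => (abs_apply_le_norm (z - y) i).trans ?_⟩
  rw [div_lt_iff₀ hℓ] at hj
  rw [pow_succ]
  linarith

theorem compl_cube_subset_iUnion (y : EuclideanSpace ℝ (Fin n)) {ℓ : ℝ} (hℓ : 0 < ℓ) :
    (cube y (2 * ℓ))ᶜ ⊆ ⋃ j : ℕ, cube y (2 ^ (j + 2) * ℓ) \ cube y (2 ^ (j + 1) * ℓ) := by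
  classical
  intro z hz
  have hex := exists_mem_cube y z hℓ
  have hmem := Nat.find_spec hex
  obtain ⟨k, hk⟩ : ∃ k, Nat.find hex = k + 1 := by
    refine ⟨Nat.find hex - 1, ?_⟩
    have : Nat.find hex ≠ 0 := by
      intro h0
      rw [h0] at hmem
      exact hz (by simpa using hmem)
    omega
  rw [hk] at hmem
  exact mem_iUnion.2 ⟨k, hmem, Nat.find_min hex (by omega)⟩

/-- The product form, cruder than the triangle inequality, separates the variables: one factor
leaves the integral, one depends only on the annulus, one stays inside. -/
theorem enorm_sub_le_mul (a c d e : 𝕜) :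
    ‖a - c‖ₑ ≤ (1 + ‖a - d‖ₑ) * (1 + ‖d - e‖ₑ) * (1 + ‖c - e‖ₑ) := by
  have h : ‖a - c‖ₑ ≤ ‖a - d‖ₑ + ‖d - e‖ₑ + ‖c - e‖ₑ := by
    calc ‖a - c‖ₑ = ‖(a - d) + (d - e) + (e - c)‖ₑ := by congr 1; ring
      _ ≤ ‖a - d‖ₑ + ‖d - e‖ₑ + ‖e - c‖ₑ :=
        (enorm_add_le _ _).trans (by gcongr; exact enorm_add_le _ _)
      _ = _ := by rw [enorm_sub_rev e c]
  refine h.trans ?_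
  generalize ‖a - d‖ₑ = A
  generalize ‖d - e‖ₑ = B
  generalize ‖c - e‖ₑ = G
  calc A + B + G ≤ A + B + G + (1 + A * B + A * G + B * G + A * B * G) := le_self_add
    _ = (1 + A) * (1 + B) * (1 + G) := by ring

/-- The part of `f` living outside a cube contributes a sum over the dilated cubes. -/
theorem lintegral_kernel_le {γ : ℝ} (hγn : γ < n) {b f : EuclideanSpace ℝ (Fin n) → 𝕜} {M : ℝ≥0}
    (hM : ∀ (x : EuclideanSpace ℝ (Fin n)) (ℓ : ℝ), 0 < ℓ → ∀ j : ℕ,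
      ‖cubeAverage b x ℓ - cubeAverage b x (2 ^ j * ℓ)‖ₑ ≤ M * j)
    (y : EuclideanSpace ℝ (Fin n)) {ℓ : ℝ} (hℓ : 0 < ℓ) {x : EuclideanSpace ℝ (Fin n)}
    (hx : x ∈ cube y ℓ) :
    ∫⁻ z, ‖b x - b z‖ₑ * ‖(f - (cube y (2 * ℓ)).indicator f) z‖ₑ / ‖x - z‖ₑ ^ ((n : ℝ) - γ) ≤
      8 ^ ((n : ℝ) - γ) * (1 + ‖b x - cubeAverage b y ℓ‖ₑ) * ∑' j : ℕ, (1 + M * (j + 2 : ℕ)) *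
        (volume (cube y (2 ^ (j + 2) * ℓ)) ^ (γ / n - 1) * ∫⁻ z in cube y (2 ^ (j + 2) * ℓ),
          (1 + ‖b z - cubeAverage b y (2 ^ (j + 2) * ℓ)‖ₑ) * ‖f z‖ₑ) := by
  have hd : 0 < (n : ℝ) - γ := by linarith
  set A : ℕ → Set (EuclideanSpace ℝ (Fin n)) := fun j =>
    cube y (2 ^ (j + 2) * ℓ) \ cube y (2 ^ (j + 1) * ℓ) with hA
  have hAm : ∀ j, MeasurableSet (A j) := fun j =>
    (measurableSet_cube _ _).diff (measurableSet_cube _ _)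
  set G : EuclideanSpace ℝ (Fin n) → ℝ≥0∞ := fun z => ‖b x - b z‖ₑ * ‖f z‖ₑ / ‖x - z‖ₑ ^ ((n : ℝ) - γ)
  have h1 : ∫⁻ z, ‖b x - b z‖ₑ * ‖(f - (cube y (2 * ℓ)).indicator f) z‖ₑ /
      ‖x - z‖ₑ ^ ((n : ℝ) - γ) ≤ ∫⁻ z in ⋃ j, A j, G z := by
    rw [← lintegral_indicator (MeasurableSet.iUnion hAm)]
    refine lintegral_mono fun z => ?_
    by_cases hz : z ∈ cube y (2 * ℓ)
    · simp [hz]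
    · rw [indicator_of_mem (compl_cube_subset_iUnion y hℓ hz)]
      simp [hz, G]
  refine h1.trans ((lintegral_iUnion_le _ _).trans ?_)
  rw [← ENNReal.tsum_mul_left]
  refine ENNReal.tsum_le_tsum fun j => ?_
  set L : ℝ := 2 ^ (j + 2) * ℓ with hL
  have hLpos : 0 < L := by positivity
  have hLe0 : ENNReal.ofReal L ≠ 0 := by simpa using hLpos
  have hpt : ∀ z ∈ A j, G z ≤ 8 ^ ((n : ℝ) - γ) * (1 + ‖b x - cubeAverage b y ℓ‖ₑ) *
      ((1 + M * (j + 2 : ℕ)) * volume (cube y L) ^ (γ / n - 1)) *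
        ((1 + ‖b z - cubeAverage b y L‖ₑ) * ‖f z‖ₑ) := by
    intro z hz
    have h2 : ENNReal.ofReal L / 8 ≤ ‖x - z‖ₑ := by
      rw [← ofReal_norm, ← ENNReal.ofReal_ofNat, ← ENNReal.ofReal_div_of_pos (by norm_num)]
      exact ENNReal.ofReal_le_ofReal (le_norm_sub_of_notMem_cube hℓ hx hz.2)
    have h3 : (‖x - z‖ₑ ^ ((n : ℝ) - γ))⁻¹ ≤
        8 ^ ((n : ℝ) - γ) * volume (cube y L) ^ (γ / n - 1) := by
      have hn : (n : ℝ) ≠ 0 := by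
        rintro h0
        have : n = 0 := by exact_mod_cast h0
        subst this
        have hz2 := hz.2
        exact hz2 (fun i => i.elim0)
      -- The kernel `|x - z|^{γ - n}` at distance comparable to `L` is the volume factor of the bump
      -- condition.
      have hvol : volume (cube y L) ^ (γ / n - 1) = (ENNReal.ofReal L ^ ((n : ℝ) - γ))⁻¹ := by
        rw [volume_cube, ← ENNReal.rpow_natCast, ← ENNReal.rpow_mul, ← ENNReal.rpow_neg]
        congr 1
        field_simp
        ring
      rw [hvol]
      calc (‖x - z‖ₑ ^ ((n : ℝ) - γ))⁻¹ ≤ ((ENNReal.ofReal L / 8) ^ ((n : ℝ) - γ))⁻¹ := by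
            gcongr
        _ = _ := by
          rw [ENNReal.div_rpow_of_nonneg _ _ hd.le, ENNReal.inv_div, div_eq_mul_inv]
          · exact Or.inl (by finiteness)
          · exact Or.inl (ENNReal.rpow_pos (by norm_num) (by norm_num)).ne'
    have h4 : ‖b x - b z‖ₑ ≤ (1 + ‖b x - cubeAverage b y ℓ‖ₑ) * (1 + M * (j + 2 : ℕ)) *
        (1 + ‖b z - cubeAverage b y L‖ₑ) := by
      refine (enorm_sub_le_mul _ _ (cubeAverage b y ℓ) (cubeAverage b y L)).trans ?_
      gcongr
      exact hM y ℓ hℓ (j + 2)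
    calc G z = ‖b x - b z‖ₑ * ‖f z‖ₑ * (‖x - z‖ₑ ^ ((n : ℝ) - γ))⁻¹ := div_eq_mul_inv _ _
      _ ≤ ((1 + ‖b x - cubeAverage b y ℓ‖ₑ) * (1 + M * (j + 2 : ℕ)) *
        (1 + ‖b z - cubeAverage b y L‖ₑ)) * ‖f z‖ₑ *
          (8 ^ ((n : ℝ) - γ) * volume (cube y L) ^ (γ / n - 1)) := by gcongr
      _ = _ := by ring
  have hVt : volume (cube y L) ^ (γ / n - 1) ≠ ∞ :=
    ENNReal.rpow_ne_top_of_ne_zero (volume_cube_ne_zero y hLpos) (volume_cube_ne_top y L)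
  calc ∫⁻ z in A j, G z ≤ ∫⁻ z in A j, 8 ^ ((n : ℝ) - γ) * (1 + ‖b x - cubeAverage b y ℓ‖ₑ) *
      ((1 + M * (j + 2 : ℕ)) * volume (cube y L) ^ (γ / n - 1)) *
        ((1 + ‖b z - cubeAverage b y L‖ₑ) * ‖f z‖ₑ) := setLIntegral_mono' (hAm j) hpt
    _ = 8 ^ ((n : ℝ) - γ) * (1 + ‖b x - cubeAverage b y ℓ‖ₑ) *
      ((1 + M * (j + 2 : ℕ)) * volume (cube y L) ^ (γ / n - 1)) *
        ∫⁻ z in A j, (1 + ‖b z - cubeAverage b y L‖ₑ) * ‖f z‖ₑ := by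
      rw [lintegral_const_mul']
      refine ENNReal.mul_ne_top (ENNReal.mul_ne_top (by finiteness) (by finiteness))
        (ENNReal.mul_ne_top (by finiteness) hVt)
    _ ≤ 8 ^ ((n : ℝ) - γ) * (1 + ‖b x - cubeAverage b y ℓ‖ₑ) *
      ((1 + M * (j + 2 : ℕ)) * volume (cube y L) ^ (γ / n - 1)) *
        ∫⁻ z in cube y L, (1 + ‖b z - cubeAverage b y L‖ₑ) * ‖f z‖ₑ := by
      gcongr
      exact sdiff_subset
    _ = _ := by ring

/-- The size condition concerns the closed support, so a whole neighbourhood of `x` must lie in the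
doubled cube, including for `x` on the boundary of `Q`. -/
theorem notMem_tsupport_sub_indicator (f : EuclideanSpace ℝ (Fin n) → 𝕜)
    {x y : EuclideanSpace ℝ (Fin n)} {ℓ : ℝ} (hℓ : 0 < ℓ) (hx : x ∈ cube y ℓ) :
    x ∉ tsupport (f - (cube y (2 * ℓ)).indicator f) := by
  rw [notMem_tsupport_iff_eventuallyEq]
  filter_upwards [Metric.ball_mem_nhds x (show 0 < ℓ / 2 by positivity)] with z hz
  have : z ∈ cube y (2 * ℓ) := by
    intro i
    have h1 := ball_subset_cube x ℓ hz i
    have h2 := hx i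
    have := abs_sub_le (z i) (x i) (y i)
    linarith
  simp [this]

/-! ### Weak-type bounds for the oscillation. -/

theorem summable_affine_mul_geometric (a c : ℝ) {r : ℝ} (hr0 : 0 ≤ r) (hr : r < 1) :
    Summable fun k : ℕ => (a + c * k) * r ^ k := by
  have h1 := (summable_geometric_of_lt_one hr0 hr).mul_left a
  have h2 := (summable_pow_mul_geometric_of_norm_lt_one 1
    (show ‖r‖ < 1 by rwa [Real.norm_of_nonneg hr0])).mul_left c
  refine (h1.add h2).congr fun k => ?_
  simp only [pow_one]
  ring

/-- The weak-type form of the weighted John–Nirenberg inequality. -/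
theorem IsBMO.exists_weak_le {b : EuclideanSpace ℝ (Fin n) → 𝕜} (hb : IsBMO b) {p : ℝ}
    (hp : 0 < p) {η : ℝ≥0} (hη1 : η < 1) {ω : Measure (EuclideanSpace ℝ (Fin n))}
    (hω : ω ≪ volume) (hη : HalfDecay η ω) :
    ∃ C : ℝ≥0, 0 < C ∧ ∀ (x : EuclideanSpace ℝ (Fin n)) (ℓ : ℝ), 0 < ℓ → ∀ s : ℝ≥0,
      s * ω {y ∈ cube x ℓ | (s : ℝ≥0∞) < 1 + ‖b y - cubeAverage b x ℓ‖ₑ} ^ (1 / p) ≤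
        C * ω (cube x ℓ) ^ (1 / p) := by
  obtain ⟨Λ, hΛ, hJN⟩ := hb.johnNirenberg
  set θ : ℝ≥0 := η ^ (1 / p)
  have hθ : θ < 1 := NNReal.rpow_lt_one hη1 (by positivity)
  have hsum := summable_affine_mul_geometric (1 + Λ) Λ θ.coe_nonneg (by exact_mod_cast hθ)
  have hnn : ∀ k : ℕ, 0 ≤ (1 + Λ + Λ * k) * (θ : ℝ) ^ k := fun k => by positivity
  set S := ∑' k : ℕ, (1 + Λ + Λ * k) * (θ : ℝ) ^ k
  have hS : 0 ≤ S := tsum_nonneg hnn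
  refine ⟨S.toNNReal + 1, by positivity, fun x ℓ hℓ s => ?_⟩
  -- For `s ≥ 1` this is the layer with `1 + kΛ ≤ s < 1 + (k+1)Λ`; for smaller `s` the floor is `0`
  -- and the layer is the whole cube. Each resulting bound is a single term of the series `S`.
  set k := ⌊((s : ℝ) - 1) / Λ⌋₊
  have hsk : (s : ℝ) ≤ 1 + Λ + Λ * k := by
    have := (Nat.lt_floor_add_one (((s : ℝ) - 1) / Λ)).le
    rw [div_le_iff₀ hΛ] at this
    linarith
  have hsub : {y ∈ cube x ℓ | (s : ℝ≥0∞) < 1 + ‖b y - cubeAverage b x ℓ‖ₑ} ⊆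
      {y ∈ cube x ℓ | k * Λ ≤ ‖b y - cubeAverage b x ℓ‖} := by
    rintro y ⟨hy, hys⟩
    refine ⟨hy, ?_⟩
    have h1 : (s : ℝ) < 1 + ‖b y - cubeAverage b x ℓ‖ := by
      rw [enorm_eq_nnnorm] at hys
      have : s < 1 + ‖b y - cubeAverage b x ℓ‖₊ := by exact_mod_cast hys
      exact_mod_cast this
    rcases le_or_gt ((s : ℝ) - 1) 0 with h | h
    · have : k = 0 := Nat.floor_of_nonpos (div_nonpos_of_nonpos_of_nonneg h hΛ.le)
      rw [this]
      simp
    · have h2 := Nat.floor_le (div_nonneg h.le hΛ.le)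
      rw [le_div_iff₀ hΛ] at h2
      change (⌊((s : ℝ) - 1) / Λ⌋₊ : ℝ) * Λ ≤ _
      linarith
  calc (s : ℝ≥0∞) * ω {y ∈ cube x ℓ | (s : ℝ≥0∞) < 1 + ‖b y - cubeAverage b x ℓ‖ₑ} ^ (1 / p)
      ≤ s * (η ^ k * ω (cube x ℓ)) ^ (1 / p) := by
        gcongr
        exact (measure_mono hsub).trans (hJN η ω hω hη k x ℓ hℓ)
    _ = (s * θ ^ k : ℝ≥0) * ω (cube x ℓ) ^ (1 / p) := by
        rw [ENNReal.mul_rpow_of_nonneg _ _ (by positivity), ← mul_assoc]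
        congr 1
        push_cast
        rw [ENNReal.coe_rpow_of_nonneg _ (by positivity), ← ENNReal.rpow_natCast,
          ← ENNReal.rpow_natCast, ← ENNReal.rpow_mul, ← ENNReal.rpow_mul, mul_comm (k : ℝ)]
    _ ≤ _ := by
        gcongr
        refine le_trans ?_ le_self_add
        rw [← NNReal.coe_le_coe, Real.coe_toNNReal _ hS]
        push_cast
        calc (s : ℝ) * θ ^ k ≤ (1 + Λ + Λ * k) * (θ : ℝ) ^ k := by gcongr
          _ ≤ S := hsum.le_tsum k fun i _ => hnn i

/-- Homogeneity of the weak norm, by substituting `s = t / B`. The value `B = ∞` must be allowed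
because the far sum may diverge; the right side is then infinite. -/
theorem weak_le_of_lt_mul {p : ℝ} (hp : 0 < p) {ω : Measure (EuclideanSpace ℝ (Fin n))}
    {Q : Set (EuclideanSpace ℝ (Fin n))} {u : EuclideanSpace ℝ (Fin n) → ℝ≥0∞} {C : ℝ≥0}
    (hC : 0 < C) (hQ : ω Q ≠ 0)
    (h : ∀ s : ℝ≥0, s * ω {y ∈ Q | (s : ℝ≥0∞) < u y} ^ (1 / p) ≤ C * ω Q ^ (1 / p))
    (B : ℝ≥0∞) (t : ℝ≥0) :
    t * ω {y ∈ Q | (t : ℝ≥0∞) < B * u y} ^ (1 / p) ≤ C * B * ω Q ^ (1 / p) := by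
  rcases eq_or_ne B 0 with rfl | hB0
  · simp [hp]
  rcases eq_or_ne B ∞ with rfl | hBt
  · have h1 : ω Q ^ (1 / p) ≠ 0 := by simp [ENNReal.rpow_eq_zero_iff, hQ, hp, hp.le]
    rw [ENNReal.mul_top (by simpa using hC.ne'), ENNReal.top_mul h1]
    exact le_top
  lift B to ℝ≥0 using hBt
  have hB0' : B ≠ 0 := by simpa using hB0
  have hset : {y ∈ Q | (t : ℝ≥0∞) < B * u y} = {y ∈ Q | ((t / B : ℝ≥0) : ℝ≥0∞) < u y} := by
    ext y
    simp only [mem_ofPred_eq, and_congr_right_iff]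
    intro _
    rw [ENNReal.coe_div hB0', ENNReal.div_lt_iff (Or.inl hB0) (Or.inl ENNReal.coe_ne_top), mul_comm]
  rw [hset]
  calc (t : ℝ≥0∞) * ω {y ∈ Q | ((t / B : ℝ≥0) : ℝ≥0∞) < u y} ^ (1 / p)
      = B * ((t / B : ℝ≥0) * ω {y ∈ Q | ((t / B : ℝ≥0) : ℝ≥0∞) < u y} ^ (1 / p)) := by
        rw [← mul_assoc, ← ENNReal.coe_mul, mul_div_cancel₀ _ hB0']
    _ ≤ B * (C * ω Q ^ (1 / p)) := mul_le_mul_right (h _) _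
    _ = _ := by ring

/-! ### Minkowski's inequality and measurability of the local norms. -/

/-- Minkowski's inequality for infinite sums of `[0, ∞]`-valued functions. -/
theorem eLpNorm_tsum_le {α : Type*} [MeasurableSpace α] {μ : Measure α} {g : ℕ → α → ℝ≥0∞}
    (hg : ∀ i, AEMeasurable (g i) μ) {q : ℝ≥0∞} (hq : 1 ≤ q) :
    eLpNorm (fun x => ∑' i, g i x) q μ ≤ ∑' i, eLpNorm (g i) q μ := by
  have hq0 : q ≠ 0 := (one_pos.trans_le hq).ne'
  rcases eq_or_ne q ∞ with rfl | hqt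
  · rw [eLpNorm_exponent_top]
    refine eLpNormEssSup_le_of_ae_enorm_bound ?_
    have : ∀ i, ∀ᵐ x ∂μ, g i x ≤ eLpNorm (g i) ∞ μ := fun i => by
      rw [eLpNorm_exponent_top]
      exact enorm_ae_le_eLpNormEssSup (g i) μ
    filter_upwards [ae_all_iff.2 this] with x hx
    exact ENNReal.tsum_le_tsum hx
  · have hqr : 0 < q.toReal := ENNReal.toReal_pos hq0 hqt
    rw [eLpNorm_eq_lintegral_rpow_enorm_toReal hq0 hqt, one_div, ENNReal.rpow_inv_le_iff hqr]
    simp only [enorm_eq_self]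
    have h1 : ∀ x, (∑' i, g i x) ^ q.toReal =
        ⨆ N : ℕ, (∑ i ∈ Finset.range N, g i x) ^ q.toReal := by
      intro x
      rw [ENNReal.tsum_eq_iSup_nat]
      exact (ENNReal.orderIsoRpow q.toReal hqr).map_iSup _
    simp only [h1]
    rw [lintegral_iSup']
    · refine iSup_le fun N => ?_
      have h2 : eLpNorm (∑ i ∈ Finset.range N, g i) q μ ≤ ∑' i, eLpNorm (g i) q μ :=
        (eLpNorm_sum_le (fun i _ => (hg i).aestronglyMeasurable) hq).trans (ENNReal.sum_le_tsum _)
      rw [eLpNorm_eq_lintegral_rpow_enorm_toReal hq0 hqt, one_div,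
        ENNReal.rpow_inv_le_iff hqr] at h2
      simpa only [enorm_eq_self, Finset.sum_apply] using h2
    · exact fun N => (Finset.aemeasurable_fun_sum _ fun i _ => hg i).pow_const _
    · refine Eventually.of_forall fun x N N' hNN' => ?_
      dsimp only
      gcongr

/-- The incidence relation between centres and points is closed in the product, so the measures of
its sections are measurable. -/
theorem measurable_measure_cube (ρ : Measure (EuclideanSpace ℝ (Fin n))) [SFinite ρ] (ℓ : ℝ) :
    Measurable fun y => ρ (cube y ℓ) := by
  have hs : MeasurableSet {z : EuclideanSpace ℝ (Fin n) × EuclideanSpace ℝ (Fin n) |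
      z.2 ∈ cube z.1 ℓ} := by
    have : {z : EuclideanSpace ℝ (Fin n) × EuclideanSpace ℝ (Fin n) | z.2 ∈ cube z.1 ℓ} =
        ⋂ i, {z | |z.2 i - z.1 i| ≤ ℓ / 2} := by
      ext z
      simp [cube]
    rw [this]
    refine IsClosed.measurableSet ?_
    exact isClosed_iInter fun i => isClosed_le (by fun_prop) continuous_const
  exact measurable_measure_prodMk_left hs

theorem lintegral_wMeasure {ν : EuclideanSpace ℝ (Fin n) → ℝ} (hν : IsWeight ν)
    (g : EuclideanSpace ℝ (Fin n) → ℝ≥0∞) :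
    ∫⁻ y, g y ∂(wMeasure ν) = ∫⁻ y, g y * ENNReal.ofReal (ν y) := by
  rw [wMeasure, lintegral_withDensity_eq_lintegral_mul_non_measurable₀ _
    hν.aemeasurable.ennreal_ofReal (Eventually.of_forall fun _ => ENNReal.ofReal_lt_top)]
  simp [mul_comm]

theorem eLpNorm_indicator_cube {p : ℝ} (hp : 0 < p) {ν : EuclideanSpace ℝ (Fin n) → ℝ}
    (hν : IsWeight ν) (f : EuclideanSpace ℝ (Fin n) → 𝕜) (y : EuclideanSpace ℝ (Fin n)) (ℓ : ℝ) :
    eLpNorm ((cube y ℓ).indicator f) (ENNReal.ofReal p) (wMeasure ν) =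
      (∫⁻ z in cube y ℓ, ‖f z‖ₑ ^ p * ENNReal.ofReal (ν z)) ^ (1 / p) := by
  rw [eLpNorm_eq_lintegral_rpow_enorm_toReal (by simpa using hp) ENNReal.ofReal_ne_top,
    ENNReal.toReal_ofReal hp.le, lintegral_wMeasure hν,
    ← lintegral_indicator (measurableSet_cube y ℓ)]
  congr 2
  ext z
  by_cases hz : z ∈ cube y ℓ <;> simp [hz, hp]

theorem lintegral_indicator_cube {p : ℝ} (hp : 0 < p) {ν : EuclideanSpace ℝ (Fin n) → ℝ}
    (f : EuclideanSpace ℝ (Fin n) → 𝕜) (y : EuclideanSpace ℝ (Fin n)) (ℓ : ℝ) :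
    ∫⁻ z, ‖(cube y ℓ).indicator f z‖ₑ ^ p * ENNReal.ofReal (ν z) =
      ∫⁻ z in cube y ℓ, ‖f z‖ₑ ^ p * ENNReal.ofReal (ν z) := by
  rw [← lintegral_indicator (measurableSet_cube y ℓ)]
  congr 1
  ext z
  by_cases hz : z ∈ cube y ℓ <;> simp [hz, hp]

/-- The local quantity whose `L^q(μ)` norm enters the amalgam norm. -/
def localNorm (p κ : ℝ) (ν w : EuclideanSpace ℝ (Fin n) → ℝ) (f : EuclideanSpace ℝ (Fin n) → 𝕜)
    (ℓ : ℝ) (y : EuclideanSpace ℝ (Fin n)) : ℝ≥0∞ :=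
  wMeasure w (cube y ℓ) ^ κ *
    (∫⁻ z in cube y ℓ, ‖f z‖ₑ ^ p * ENNReal.ofReal (ν z)) ^ (1 / p)

theorem measurable_localNorm {p κ : ℝ} {ν w : EuclideanSpace ℝ (Fin n) → ℝ}
    (f : EuclideanSpace ℝ (Fin n) → 𝕜) (ℓ : ℝ) : Measurable (localNorm p κ ν w f ℓ) := by
  have h1 : Measurable fun y => wMeasure w (cube y ℓ) := by
    have : SFinite (wMeasure w) := by unfold wMeasure; infer_instance
    exact measurable_measure_cube _ ℓ
  have h2 := measurable_measure_cube
    (volume.withDensity fun z => ‖f z‖ₑ ^ p * ENNReal.ofReal (ν z)) ℓ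
  simp only [withDensity_apply _ (measurableSet_cube _ _)] at h2
  exact (h1.pow_const _).mul (h2.pow_const _)

theorem eLpNorm_localNorm_le {p α : ℝ} {q : ℝ≥0∞} (hp : 0 < p)
    {ν w μ : EuclideanSpace ℝ (Fin n) → ℝ} (hν : IsWeight ν)
    (f : EuclideanSpace ℝ (Fin n) → 𝕜) {ℓ : ℝ} (hℓ : 0 < ℓ) :
    eLpNorm (localNorm p (1 / α - 1 / p - (1 / q).toReal) ν w f ℓ) q (wMeasure μ) ≤
      amalgamNorm p α q ν w μ f := by
  unfold amalgamNorm
  simp only [eLpNorm_indicator_cube hp hν]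
  exact le_iSup₂ (f := fun (ℓ : ℝ) (_ : 0 < ℓ) =>
    eLpNorm (localNorm p (1 / α - 1 / p - (1 / q).toReal) ν w f ℓ) q (wMeasure μ)) ℓ hℓ

/-! ### The local weak-type estimate. -/

/-- If the sum exceeds `σ`, one summand exceeds `σ/2`, whence the factors `2`; subadditivity of the
power `1/p` separates the measures. Level sets of `F₁` are global, as in the weak-type hypothesis,
whereas `F₂` is controlled only on `Q`. -/
theorem weakLpNorm_indicator_le_add {p : ℝ} (hp : 1 < p) {w : EuclideanSpace ℝ (Fin n) → ℝ}
    {Q : Set (EuclideanSpace ℝ (Fin n))} {g : EuclideanSpace ℝ (Fin n) → 𝕜}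
    {F₁ F₂ : EuclideanSpace ℝ (Fin n) → ℝ≥0∞} {R₁ R₂ : ℝ≥0∞}
    (hg : ∀ᵐ x ∂volume, x ∈ Q → ‖g x‖ₑ ≤ F₁ x + F₂ x)
    (h₁ : ∀ t : ℝ≥0, 0 < t → t * wMeasure w {x | (t : ℝ≥0∞) < F₁ x} ^ (1 / p) ≤ R₁)
    (h₂ : ∀ t : ℝ≥0, 0 < t → t * wMeasure w {x ∈ Q | (t : ℝ≥0∞) < F₂ x} ^ (1 / p) ≤ R₂) :
    weakLpNorm p w (Q.indicator g) ≤ 2 * R₁ + 2 * R₂ := by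
  refine iSup₂_le fun σ hσ => ?_
  set t : ℝ≥0 := (σ / 2).toNNReal
  have ht : 0 < t := Real.toNNReal_pos.2 (by linarith)
  have hσt : ENNReal.ofReal σ = 2 * t := by
    change _ = 2 * ENNReal.ofReal (σ / 2)
    rw [← ENNReal.ofReal_ofNat, ← ENNReal.ofReal_mul (by norm_num)]
    congr 1
    ring
  have hsub : {x | σ < ‖Q.indicator g x‖} ≤ᵐ[volume]
      ({x | (t : ℝ≥0∞) < F₁ x} ∪ {x ∈ Q | (t : ℝ≥0∞) < F₂ x} : Set _) := by
    filter_upwards [hg] with x hx hxσ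
    have hxσ : σ < ‖Q.indicator g x‖ := hxσ
    by_cases hxQ : x ∈ Q
    · rw [indicator_of_mem hxQ] at hxσ
      have h1 : (2 * t : ℝ≥0∞) < F₁ x + F₂ x := by
        rw [← hσt]
        refine lt_of_lt_of_le ?_ (hx hxQ)
        rw [← ofReal_norm]
        exact (ENNReal.ofReal_lt_ofReal_iff (hσ.trans hxσ)).2 hxσ
      by_contra hcon
      have hcon' : ¬((t : ℝ≥0∞) < F₁ x ∨ (x ∈ Q ∧ (t : ℝ≥0∞) < F₂ x)) := hcon
      push Not at hcon'
      refine absurd h1 (not_lt.2 ?_)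
      rw [two_mul]
      exact add_le_add hcon'.1 (hcon'.2 hxQ)
    · rw [indicator_of_notMem hxQ, norm_zero] at hxσ
      exact absurd hxσ hσ.le.not_gt
  calc ENNReal.ofReal σ * wMeasure w {x | σ < ‖Q.indicator g x‖} ^ (1 / p)
      ≤ ENNReal.ofReal σ * (wMeasure w {x | (t : ℝ≥0∞) < F₁ x} +
          wMeasure w {x ∈ Q | (t : ℝ≥0∞) < F₂ x}) ^ (1 / p) := by
        gcongr
        exact (measure_mono_ae ((wMeasure_absolutelyContinuous w).ae_le hsub)).trans
          (measure_union_le _ _)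
    _ ≤ ENNReal.ofReal σ * (wMeasure w {x | (t : ℝ≥0∞) < F₁ x} ^ (1 / p) +
          wMeasure w {x ∈ Q | (t : ℝ≥0∞) < F₂ x} ^ (1 / p)) := by
        gcongr
        exact ENNReal.rpow_add_le_add_rpow _ _ (by positivity)
          (by rw [div_le_one (by linarith)]; exact hp.le)
    _ = 2 * (t * wMeasure w {x | (t : ℝ≥0∞) < F₁ x} ^ (1 / p)) +
          2 * (t * wMeasure w {x ∈ Q | (t : ℝ≥0∞) < F₂ x} ^ (1 / p)) := by
        rw [hσt]; ring
    _ ≤ 2 * R₁ + 2 * R₂ := by gcongr; exacts [h₁ t ht, h₂ t ht]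

theorem weakLpNorm_indicator_eq_zero {p : ℝ} (hp : 0 < p) {w : EuclideanSpace ℝ (Fin n) → ℝ}
    {Q : Set (EuclideanSpace ℝ (Fin n))} (hQ : wMeasure w Q = 0)
    (g : EuclideanSpace ℝ (Fin n) → 𝕜) : weakLpNorm p w (Q.indicator g) = 0 := by
  refine le_antisymm (iSup₂_le fun σ hσ => ?_) (zero_le)
  have : wMeasure w {x | σ < ‖Q.indicator g x‖} = 0 := by
    refine measure_mono_null (fun x hx => ?_) hQ
    by_contra hxQ
    have hx : σ < ‖Q.indicator g x‖ := hx
    rw [indicator_of_notMem hxQ, norm_zero] at hx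
    linarith
  rw [this, ENNReal.zero_rpow_of_pos (by positivity), mul_zero]

/-- The pointwise estimate: the local weak norm of `T f` is controlled by a summable combination of
local norms of `f` over dilated cubes. -/
theorem exists_local_weak_le {γ p κ r : ℝ} (hγ : 0 < γ) (hγn : γ < n) (hp : 1 < p) (hκ : κ ≤ 0)
    (hδ : 0 < κ + 1 / p) {w ν : EuclideanSpace ℝ (Fin n) → ℝ} (hw : IsWeight w) (hν : IsWeight ν)
    (hwA : IsMuckenhouptInfty w) (hr : 1 < r) (hwν : BumpCondition γ p r w ν)
    {b : EuclideanSpace ℝ (Fin n) → 𝕜} (hb : IsBMO b)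
    {D : Submodule 𝕜 (EuclideanSpace ℝ (Fin n) → 𝕜)}
    {T : (EuclideanSpace ℝ (Fin n) → 𝕜) → (EuclideanSpace ℝ (Fin n) → 𝕜)}
    (hT : IsSublinearOperator D T) (hT_size : CommutatorSize γ b D T)
    (hT_weak : WeakType p w ν D T) :
    ∃ a : ℕ → ℝ≥0, Summable a ∧ ∀ f ∈ D, ∀ (ℓ : ℝ), 0 < ℓ → ∀ y,
      wMeasure w (cube y ℓ) ^ κ * weakLpNorm p w ((cube y ℓ).indicator (T f)) ≤
        ∑' k, a k * localNorm p κ ν w f (2 ^ k * ℓ) y := by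
  have hp0 : 0 < p := by linarith
  have hn : 0 < n := by
    have : (0 : ℝ) < n := hγ.trans hγn
    exact_mod_cast this
  obtain ⟨η, hη1, hη⟩ := hwA.halfDecay hw
  obtain ⟨Cd, hCd⟩ := hwA.doubling hw
  obtain ⟨M, hM⟩ := hb.exists_enorm_cubeAverage_sub_le
  obtain ⟨Cw, hCw0, hCw⟩ := hb.exists_weak_le hp0 hη1 (wMeasure_absolutelyContinuous w) hη
  obtain ⟨Cb, hCb⟩ := hwν.exists_lintegral_le hb hp hr hw hν
  obtain ⟨cS, hcS⟩ := hT_size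
  obtain ⟨CT, hCT⟩ := hT_weak
  set δ := κ + 1 / p with hδdef
  set θ : ℝ≥0 := η ^ δ
  have hθ : θ < 1 := NNReal.rpow_lt_one hη1 hδ
  set K₁ : ℝ≥0 := 2 * CT ^ (1 / p) * (Cd + 1) ^ (-κ)
  set K₂ : ℝ≥0 := 2 * Cw * (cS * (8 ^ ((n : ℝ) - γ) * Cb))
  -- The near part lives on the doubled cube and contributes only at `k = 1`; the remaining term is
  -- the far part, linear growth times geometric decay.
  refine ⟨fun k => (if k = 1 then K₁ else 0) + K₂ * ((1 + M * k) * θ ^ k), ?_, ?_⟩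
  · refine Summable.add (summable_of_hasFiniteSupport ?_) (Summable.mul_left _ ?_)
    · refine (finite_singleton 1).subset fun k hk => ?_
      by_contra h
      exact hk (if_neg h)
    · rw [← NNReal.summable_coe]
      exact_mod_cast summable_affine_mul_geometric 1 M θ.coe_nonneg (by exact_mod_cast hθ)
  intro f hf ℓ hℓ y
  set Q := cube y ℓ with hQ
  set W := wMeasure w Q with hW
  -- For a null cube `W ^ κ` may be `∞`, but the weak norm vanishes and the product is `0`.
  rcases eq_or_ne W 0 with hW0 | hW0
  · rw [weakLpNorm_indicator_eq_zero hp0 hW0, mul_zero]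
    exact zero_le
  have hWt : W ≠ ∞ := hw.wMeasure_cube_ne_top y hℓ.le
  set Wk : ℕ → ℝ≥0∞ := fun k => wMeasure w (cube y (2 ^ k * ℓ)) with hWk
  have hWkt : ∀ k, Wk k ≠ ∞ := fun k => hw.wMeasure_cube_ne_top y (by positivity)
  have hWk0 : ∀ k, Wk k ≠ 0 := fun k h0 => hW0 (measure_mono_null
    (cube_subset_cube y (le_mul_of_one_le_left hℓ.le (one_le_pow₀ (by norm_num)))) h0)
  set N : ℕ → ℝ≥0∞ := fun k =>
    (∫⁻ z in cube y (2 ^ k * ℓ), ‖f z‖ₑ ^ p * ENNReal.ofReal (ν z)) ^ (1 / p) with hN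
  have hloc : ∀ k, localNorm p κ ν w f (2 ^ k * ℓ) y = Wk k ^ κ * N k := fun k => rfl
  have hfm : AEStronglyMeasurable f volume := (hT.locallyIntegrable f hf).aestronglyMeasurable
  set f₁ := (cube y (2 * ℓ)).indicator f with hf₁
  have hf₁D : f₁ ∈ D := hT.restrict_mem f hf y (2 * ℓ) (by positivity)
  have hf₂D : f - f₁ ∈ D := D.sub_mem hf hf₁D
  set S : ℝ≥0∞ := ∑' j : ℕ, (1 + M * (j + 2 : ℕ)) * (Cb * (Wk (j + 2) ^ (-(1 / p)) * N (j + 2)))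
  set B : ℝ≥0∞ := cS * (8 ^ ((n : ℝ) - γ) * S) with hB
  have hfar : ∀ᵐ x ∂volume, x ∈ Q → ‖T (f - f₁) x‖ₑ ≤ B * (1 + ‖b x - cubeAverage b y ℓ‖ₑ) := by
    filter_upwards [hcS _ hf₂D] with x hx hxQ
    refine (hx (notMem_tsupport_sub_indicator f hℓ hxQ)).trans ?_
    calc _ ≤ cS * (8 ^ ((n : ℝ) - γ) * (1 + ‖b x - cubeAverage b y ℓ‖ₑ) *
        ∑' j : ℕ, (1 + M * (j + 2 : ℕ)) *
        (volume (cube y (2 ^ (j + 2) * ℓ)) ^ (γ / n - 1) * ∫⁻ z in cube y (2 ^ (j + 2) * ℓ),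
          (1 + ‖b z - cubeAverage b y (2 ^ (j + 2) * ℓ)‖ₑ) * ‖f z‖ₑ)) := by
          gcongr
          exact lintegral_kernel_le hγn hM y hℓ hxQ
      _ ≤ cS * (8 ^ ((n : ℝ) - γ) * (1 + ‖b x - cubeAverage b y ℓ‖ₑ) * S) := by
          gcongr
          refine ENNReal.tsum_le_tsum fun j => mul_le_mul_right ?_ _
          have h := hCb f hfm y (2 ^ (j + 2) * ℓ) (by positivity)
          have hinv : Wk (j + 2) ^ (-(1 / p)) * Wk (j + 2) ^ (1 / p) = 1 := by
            rw [← ENNReal.rpow_add _ _ (hWk0 _) (hWkt _)]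
            simp
          generalize volume (cube y (2 ^ (j + 2) * ℓ)) ^ (γ / n - 1) * lintegral _ _ = X at h ⊢
          rw [← one_mul X, ← hinv, mul_assoc]
          refine (mul_le_mul_right h _).trans_eq ?_
          ring
      _ = _ := by rw [hB]; ring
  have hmain : weakLpNorm p w (Q.indicator (T f)) ≤
      2 * (CT ^ (1 / p) * N 1) + 2 * (Cw * B * W ^ (1 / p)) := by
    refine weakLpNorm_indicator_le_add hp (F₁ := fun x => ‖T f₁ x‖ₑ)
      (F₂ := fun x => B * (1 + ‖b x - cubeAverage b y ℓ‖ₑ)) ?_ ?_ ?_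
    · filter_upwards [hT.add_le f₁ hf₁D (f - f₁) hf₂D, hfar] with x h1 h2 hxQ
      rw [add_sub_cancel] at h1
      refine le_trans ?_ (add_le_add_right (h2 hxQ) _)
      rw [enorm_eq_nnnorm, enorm_eq_nnnorm, enorm_eq_nnnorm]
      exact_mod_cast h1
    · intro t ht
      have ht0 : (t : ℝ≥0∞) ≠ 0 := by simpa using ht.ne'
      have h := hCT f₁ hf₁D t ht
      rw [hf₁, lintegral_indicator_cube hp0, ← hf₁, ENNReal.ofReal_coe_nnreal] at h
      have hset : {x | (t : ℝ≥0∞) < ‖T f₁ x‖ₑ} = {x | (t : ℝ) < ‖T f₁ x‖} := by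
        ext x
        simp only [mem_ofPred_eq, enorm_eq_nnnorm, ENNReal.coe_lt_coe, ← NNReal.coe_lt_coe,
          coe_nnnorm]
      rw [hset]
      calc (t : ℝ≥0∞) * wMeasure w {x | (t : ℝ) < ‖T f₁ x‖} ^ (1 / p)
          ≤ t * (CT / t ^ p * ∫⁻ z in cube y (2 * ℓ), ‖f z‖ₑ ^ p * ENNReal.ofReal (ν z)) ^ (1 / p) := by
            gcongr
        _ = (t * (t : ℝ≥0∞)⁻¹) * (CT ^ (1 / p) * N 1) := by
            rw [ENNReal.mul_rpow_of_nonneg _ _ (by positivity),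
              ENNReal.div_rpow_of_nonneg _ _ (by positivity), ← ENNReal.rpow_mul,
              mul_one_div_cancel hp0.ne', ENNReal.rpow_one, div_eq_mul_inv, hN]
            simp only [pow_one]
            ring
        _ = _ := by rw [ENNReal.mul_inv_cancel ht0 ENNReal.coe_ne_top, one_mul]
    · intro t _
      exact weak_le_of_lt_mul hp0 hCw0 hW0 (fun s => hCw y ℓ hℓ s) B t
  -- As `κ ≤ 0`, the power reverses the doubling inequality; the constant `Cd + 1` is nonzero, so
  -- that its powers can be cancelled.
  have hnear : W ^ κ ≤ (Cd + 1 : ℝ≥0) ^ (-κ) * Wk 1 ^ κ := by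
    have h1 : Wk 1 ≤ (Cd + 1 : ℝ≥0) * W := by
      refine (le_of_eq (by simp [hWk])).trans ((hCd y ℓ hℓ).trans ?_)
      gcongr
      simp
    have h2 : ((Cd + 1 : ℝ≥0) * W : ℝ≥0∞) ^ κ ≤ Wk 1 ^ κ := by
      rw [← neg_neg κ, ENNReal.rpow_neg, ENNReal.rpow_neg (Wk 1)]
      exact ENNReal.inv_le_inv.2 (ENNReal.rpow_le_rpow h1 (neg_nonneg.2 hκ))
    have hC0 : ((Cd + 1 : ℝ≥0) : ℝ≥0∞) ≠ 0 := by simp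
    rw [ENNReal.mul_rpow_of_ne_zero hC0 hW0] at h2
    calc W ^ κ = ((Cd + 1 : ℝ≥0) : ℝ≥0∞) ^ (-κ) * (((Cd + 1 : ℝ≥0) : ℝ≥0∞) ^ κ * W ^ κ) := by
          rw [← mul_assoc, ← ENNReal.rpow_add _ _ hC0 ENNReal.coe_ne_top]
          simp
      _ ≤ _ := mul_le_mul_right h2 _
  -- The decisive gain: the powers of `W` combine to `W ^ δ` with `δ > 0`, and `W ≤ η^k Wk k` yields
  -- `θ ^ k` with `θ = η ^ δ < 1`.
  have hterm : ∀ k, W ^ κ * W ^ (1 / p) * (Wk k ^ (-(1 / p)) * N k) ≤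
      θ ^ k * (Wk k ^ κ * N k) := by
    intro k
    rw [← ENNReal.rpow_add _ _ hW0 hWt, ← hδdef]
    calc W ^ δ * (Wk k ^ (-(1 / p)) * N k) ≤ (η ^ k * Wk k) ^ δ * (Wk k ^ (-(1 / p)) * N k) := by
          gcongr
          exact hη.cube_le hn y hℓ k
      _ = (η ^ k : ℝ≥0∞) ^ δ * ((Wk k ^ δ * Wk k ^ (-(1 / p))) * N k) := by
          rw [ENNReal.mul_rpow_of_nonneg _ _ hδ.le]; ring
      _ = _ := by
          rw [← ENNReal.rpow_add _ _ (hWk0 k) (hWkt k), hδdef, add_neg_cancel_right,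
            ENNReal.coe_rpow_of_nonneg _ hδ.le, ← ENNReal.rpow_natCast, ← ENNReal.rpow_natCast,
            ← ENNReal.rpow_mul, ← ENNReal.rpow_mul, mul_comm (k : ℝ)]
  have hfarsum : W ^ κ * (2 * (Cw * B * W ^ (1 / p))) ≤
      ∑' k : ℕ, K₂ * ((1 + M * k) * θ ^ k) * (Wk k ^ κ * N k) := by
    calc W ^ κ * (2 * (Cw * B * W ^ (1 / p)))
        = ∑' j : ℕ, K₂ * (1 + M * (j + 2 : ℕ)) *
            (W ^ κ * W ^ (1 / p) * (Wk (j + 2) ^ (-(1 / p)) * N (j + 2))) := by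
          have : W ^ κ * (2 * (Cw * B * W ^ (1 / p))) =
              (2 * Cw * (cS * 8 ^ ((n : ℝ) - γ)) * (W ^ κ * W ^ (1 / p))) * S := by
            rw [hB]; ring
          rw [this, ← ENNReal.tsum_mul_left]
          refine tsum_congr fun j => ?_
          simp only [K₂]
          push_cast
          rw [ENNReal.coe_rpow_of_nonneg _ (by linarith)]
          push_cast
          ring
      _ ≤ ∑' j : ℕ, K₂ * ((1 + M * (j + 2 : ℕ)) * θ ^ (j + 2)) * (Wk (j + 2) ^ κ * N (j + 2)) := by
          refine ENNReal.tsum_le_tsum fun j => ?_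
          refine (mul_le_mul_right (hterm (j + 2)) _).trans_eq ?_
          ring
      _ ≤ _ := ENNReal.tsum_comp_le_tsum_of_injective (add_left_injective 2)
          (fun k : ℕ => (K₂ : ℝ≥0∞) * ((1 + M * k) * θ ^ k) * (Wk k ^ κ * N k))
  calc W ^ κ * weakLpNorm p w (Q.indicator (T f))
      ≤ W ^ κ * (2 * (CT ^ (1 / p) * N 1) + 2 * (Cw * B * W ^ (1 / p))) := by gcongr
    _ = W ^ κ * (2 * (CT ^ (1 / p) * N 1)) + W ^ κ * (2 * (Cw * B * W ^ (1 / p))) := mul_add _ _ _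
    _ ≤ K₁ * (Wk 1 ^ κ * N 1) + ∑' k : ℕ, K₂ * ((1 + M * k) * θ ^ k) * (Wk k ^ κ * N k) := by
        refine add_le_add ?_ hfarsum
        calc W ^ κ * (2 * (CT ^ (1 / p) * N 1))
            ≤ (Cd + 1 : ℝ≥0) ^ (-κ) * Wk 1 ^ κ * (2 * (CT ^ (1 / p) * N 1)) := by gcongr
          _ = _ := by
            simp only [K₁]
            push_cast
            rw [ENNReal.coe_rpow_of_nonneg _ (by positivity),
              ENNReal.coe_rpow_of_nonneg _ (by linarith)]
            push_cast
            ring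
    _ = ∑' k : ℕ, ((if k = 1 then K₁ else 0 : ℝ≥0) : ℝ≥0∞) * (Wk k ^ κ * N k) +
          ∑' k : ℕ, K₂ * ((1 + M * k) * θ ^ k) * (Wk k ^ κ * N k) := by
        congr 1
        rw [tsum_eq_single 1 fun k hk => by simp [hk]]
        simp
    _ = _ := by
        rw [← ENNReal.tsum_add]
        refine tsum_congr fun k => ?_
        rw [hloc]
        push_cast
        ring

end WeightedAmalgam

end

/-! ### The norm inequality. -/

theorem theorem1p8 {n : ℕ} {𝕜 : Type*} [RCLike 𝕜]
    (γ p α : ℝ) (q : ℝ≥0∞)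
    (hγ : 0 < γ) (hγn : γ < n) (hp : 1 < p) (hpα : p ≤ α) (hαq : ENNReal.ofReal α < q)
    (w ν μ : EuclideanSpace ℝ (Fin n) → ℝ)
    (hw : WeightedAmalgam.IsWeight w) (hν : WeightedAmalgam.IsWeight ν)
    (hμ : WeightedAmalgam.IsWeight μ)
    (hμ_doubling : WeightedAmalgam.IsDoubling μ)
    (hwA : WeightedAmalgam.IsMuckenhouptInfty w)
    (hwν : ∃ r : ℝ, 1 < r ∧ WeightedAmalgam.BumpCondition γ p r w ν)
    (b : EuclideanSpace ℝ (Fin n) → 𝕜) (hb : WeightedAmalgam.IsBMO b)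
    (D : Submodule 𝕜 (EuclideanSpace ℝ (Fin n) → 𝕜))
    (T : (EuclideanSpace ℝ (Fin n) → 𝕜) → (EuclideanSpace ℝ (Fin n) → 𝕜))
    (hT : WeightedAmalgam.IsSublinearOperator D T)
    (hT_size : WeightedAmalgam.CommutatorSize γ b D T)
    (hT_weak : WeightedAmalgam.WeakType p w ν D T) :
    ∃ C : ℝ≥0, ∀ f ∈ D, WeightedAmalgam.MemAmalgam p α q ν w μ f →
      WeightedAmalgam.MemWeakAmalgam p α q w μ (T f) ∧
        WeightedAmalgam.weakAmalgamNorm p α q w μ (T f) ≤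
          C * WeightedAmalgam.amalgamNorm p α q ν w μ f := by
  obtain ⟨r, hr, hwν⟩ := hwν
  have hp0 : 0 < p := by linarith
  have hα0 : 0 < α := by linarith
  have hq1 : 1 ≤ q := by
    refine le_trans ?_ hαq.le
    rw [← ENNReal.ofReal_one]
    exact ENNReal.ofReal_le_ofReal (by linarith)
  have hκ : 1 / α - 1 / p - (1 / q).toReal ≤ 0 := by
    have h1 : 1 / α ≤ 1 / p := one_div_le_one_div_of_le hp0 hpα
    have h2 : 0 ≤ (1 / q).toReal := ENNReal.toReal_nonneg
    linarith
  have hδ : 0 < 1 / α - 1 / p - (1 / q).toReal + 1 / p := by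
    have h1 : (1 / q).toReal < 1 / α := by
      have h2 : 1 / q < ENNReal.ofReal (1 / α) := by
        rw [one_div, one_div, ENNReal.ofReal_inv_of_pos hα0]
        exact ENNReal.inv_lt_inv.2 hαq
      rw [← ENNReal.toReal_ofReal (show 0 ≤ 1 / α by positivity)]
      exact (ENNReal.toReal_lt_toReal h2.ne_top ENNReal.ofReal_ne_top).2 h2
    linarith
  obtain ⟨a, ha, hpt⟩ := WeightedAmalgam.exists_local_weak_le hγ hγn hp hκ hδ hw hν hwA hr hwν hb
    hT hT_size hT_weak
  refine ⟨∑' k, a k, fun f hf hfA => ?_⟩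
  have key : WeightedAmalgam.weakAmalgamNorm p α q w μ (T f) ≤
      (∑' k, a k : ℝ≥0) * WeightedAmalgam.amalgamNorm p α q ν w μ f := by
    refine iSup₂_le fun ℓ hℓ => ?_
    -- At fixed `ℓ`, the pointwise bound and Minkowski give a sum of norms at the scales `2^k ℓ`.
    -- Each is at most the amalgam norm, a supremum over all scales, so the bound is uniform in `ℓ`.
    refine (eLpNorm_mono_enorm (g := fun y => ∑' k, (a k : ℝ≥0∞) * WeightedAmalgam.localNorm p
      (1 / α - 1 / p - (1 / q).toReal) ν w f (2 ^ k * ℓ) y) fun y => ?_).trans ?_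
    · simpa only [enorm_eq_self] using hpt f hf ℓ hℓ y
    refine (WeightedAmalgam.eLpNorm_tsum_le (fun k =>
      ((WeightedAmalgam.measurable_localNorm f _).const_mul _).aemeasurable) hq1).trans ?_
    rw [ENNReal.coe_tsum ha, ← ENNReal.tsum_mul_right]
    refine ENNReal.tsum_le_tsum fun k => ?_
    refine (eLpNorm_le_nnreal_smul_eLpNorm_of_ae_le_mul' (c := a k)
      (g := WeightedAmalgam.localNorm p (1 / α - 1 / p - (1 / q).toReal) ν w f (2 ^ k * ℓ))
      (Filter.Eventually.of_forall fun y => by simp only [enorm_eq_self]; exact le_rfl) q).trans ?_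
    rw [ENNReal.smul_def, smul_eq_mul]
    gcongr
    exact WeightedAmalgam.eLpNorm_localNorm_le hp0 hν f (by positivity)
  exact ⟨⟨hT.measurable f hf, key.trans_lt (ENNReal.mul_lt_top ENNReal.coe_lt_top hfA.2)⟩, key⟩
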